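/- Let $\Omega\subset\mathbb R^N$ be an unbounded domain with smooth bounded boundary, $T>0$, $H:=L^2(\Omega)$, $V:=H^1(\Omega)$, $W:=\{z\in H^2(\Omega)\mid \partial_\nu z=0 \text{ on }\partial\Omega\}$, and let $V^*$ be the dual of $V$ with the norm dual to $|\cdot|_V$; $H$ is embedded in $V^*$ by $\langle h,z\rangle_{V^*,V}=(h,z)_H$. Assume: (C1) $\hat\beta:\mathbb R\to[0,\infty)$ is convex and differentiable, $\hat\beta(0)=0$, and $\beta=\hat\beta'=\partial\hat\beta:\mathbb R\to\mathbb R$ (a single-valued maximal monotone function); there is $c_1>0$ with $\hat\beta(r)\ge c_1|r|^2$ for all $r\in\mathbb R$; for all $z\in L^2(\Omega)$ with $\hat\beta(z)\in L^1(\Omega)$ one has $\beta(z)\in L^1_{\rm loc}(\Omega)$ and $\hat\beta(z+\psi)\in L^1(\Omega)$ for all $\psi\in C_c^\infty(\Omega)$. (C2) $g\in L^2(0,T;L^2(\Omega))$, and $f\in L^2(0,T;H^2(\Omega))$ satisfies $(-\Delta+1)f(t)=g(t)$ a.e. in $\Omega$ and $\partial_\nu f(t)=0$ on $\partial\Omega$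 for a.a. $t\in(0,T)$. (C3) $u_0\in L^2(\Omega)$ and $\hat\beta(u_0)\in L^1(\Omega)$. (C4) For every $\varepsilon\in(0,1]$, $\pi_\varepsilon:\mathbb R\to\mathbb R$ is Lipschitz continuous, $\pi_\varepsilon(0)=0$, $|\pi_\varepsilon'|_{L^\infty(\mathbb R)}\le c_2(\varepsilon)$ with $c_2(\varepsilon)>0$, and $r\mapsto\frac{\varepsilon}{2}r^2+\int_0^r\pi_\varepsilon(s)\,ds$ is convex; moreover $c_2(\varepsilon)<2c_1$ for all sufficiently small $\varepsilon$. (C5) For every $\varepsilon\in(0,1]$, $u_{0\varepsilon}\in H^1(\Omega)$, $\hat\beta(u_{0\varepsilon})\in L^1(\Omega)$, and $|u_{0\varepsilon}|_{L^2(\Omega)}^2\le c_3(\varepsilon)$, $\int_\Omega\hat\beta(u_{0\varepsilon})\le c_3(\varepsilon)$, $\varepsilon|u_{0\varepsilon}|^2_{H^1(\Omega)}\le c_3(\varepsilon)$ with $c_3(\varepsilon)>0$. A weak solution of (P) is a pair $(u,\mu)$ with $u\in H^1(0,T;V^*)\cap L^\infty(0,T;H)$ and $\mu\in L^2(0,T;V)$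 such that, for a.a. $t\in(0,T)$, $\langle u'(t),z\rangle_{V^*,V}+(\mu(t),z)_V=0$ for all $z\in V$ and $\mu(t)=\beta(u(t))-f(t)$, and $u(0)=u_0$. A weak solution of (P)$_\varepsilon$ is a pair $(u_\varepsilon,\mu_\varepsilon)$ with $u_\varepsilon\in H^1(0,T;V^*)\cap L^\infty(0,T;V)\cap L^2(0,T;W)$ and $\mu_\varepsilon\in L^2(0,T;V)$ such that, for a.a. $t\in(0,T)$, $\langle u_\varepsilon'(t),z\rangle_{V^*,V}+(\mu_\varepsilon(t),z)_V=0$ for all $z\in V$ and $\mu_\varepsilon(t)=\varepsilon(-\Delta+I)u_\varepsilon(t)+\beta(u_\varepsilon(t))+\pi_\varepsilon(u_\varepsilon(t))-f(t)$, and $u_\varepsilon(0)=u_{0\varepsilon}$. **Theorem 5.1.** In addition to (C1)–(C5), suppose that there are constants $\tilde c_2,\tilde c_3,c_4>0$ independent of $\varepsilon$ such that, for all $\varepsilon\in(0,1]$, $c_2(\varepsilon)=\tilde c_2\varepsilon$, $c_3(\varepsilon)=\tilde c_3$ and $|u_{0\varepsilon}-u_0|_{V^*}\le c_4\varepsilon^{1/4}$.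 Then there exist constants $C^*>0$ and $\overline\varepsilon\in(0,1]$, independent of $\varepsilon$, such that for every $\varepsilon\in(0,\overline\varepsilon]$ and all weak solutions $(u,\mu)$ of (P) and $(u_\varepsilon,\mu_\varepsilon)$ of (P)$_\varepsilon$, the functions $\beta(u(s))$ and $\beta(u_\varepsilon(s))$ belong to $H$ for a.a. $s\in(0,T)$, the integral below exists, and $$|u_\varepsilon-u|^2_{C([0,T];V^*)}+\int_0^T\bigl(\beta(u_\varepsilon(s))-\beta(u(s)),\,u_\varepsilon(s)-u(s)\bigr)_H\,ds\le C^*\varepsilon^{1/2}.$$ -/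

import Mathlib

open MeasureTheory Set Filter Topology
open scoped ContDiff ENNReal InnerProductSpace

noncomputable section

namespace QuasilinearParabolic

/-! ## Domains -/

/-- The boundary of `Ω` is smooth: near each boundary point, `Ω` is the sublevel set `{ρ < 0}` of
a `C^∞` function `ρ` whose differential does not vanish at that point. -/
def HasSmoothBoundary {N : ℕ} (Ω : Set (EuclideanSpace ℝ (Fin N))) : Prop :=
  ∀ x ∈ frontier Ω, ∃ (U : Set (EuclideanSpace ℝ (Fin N))) (ρ : EuclideanSpace ℝ (Fin N) → ℝ),
    IsOpen U ∧ x ∈ U ∧ ContDiffOn ℝ ∞ ρ U ∧ fderiv ℝ ρ x ≠ 0 ∧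
      ∀ y ∈ U, (y ∈ Ω ↔ ρ y < 0)

/-- `Ω` is an unbounded domain (open, connected, nonempty) with smooth bounded boundary. -/
structure IsAdmissibleDomain {N : ℕ} (Ω : Set (EuclideanSpace ℝ (Fin N))) : Prop where
  isOpen : IsOpen Ω
  isConnected : IsConnected Ω
  unbounded : ¬ Bornology.IsBounded Ω
  boundary_bounded : Bornology.IsBounded (frontier Ω)
  boundary_smooth : HasSmoothBoundary Ω

/-! ## Lebesgue and Sobolev spaces on `Ω` -/

/-- The Hilbert space `H = L²(Ω)`. -/
abbrev L2 {N : ℕ} (Ω : Set (EuclideanSpace ℝ (Fin N))) : Type :=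
  Lp ℝ 2 ((volume : Measure (EuclideanSpace ℝ (Fin N))).restrict Ω)

/-- `φ ∈ C_c^∞(Ω)`. -/
structure IsTestFunction {N : ℕ} (Ω : Set (EuclideanSpace ℝ (Fin N)))
    (φ : EuclideanSpace ℝ (Fin N) → ℝ) : Prop where
  contDiff : ContDiff ℝ ∞ φ
  hasCompactSupport : HasCompactSupport φ
  tsupport_subset : tsupport φ ⊆ Ω

/-- The classical partial derivative `∂φ/∂xᵢ`. -/
def partialDeriv {N : ℕ} (i : Fin N) (φ : EuclideanSpace ℝ (Fin N) → ℝ)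
    (x : EuclideanSpace ℝ (Fin N)) : ℝ :=
  fderiv ℝ φ x (EuclideanSpace.single i 1)

/-- `p ∈ L²(Ω)` is the weak partial derivative `∂w/∂xᵢ` of `w ∈ L²(Ω)` in `Ω`. -/
def HasWeakDeriv {N : ℕ} {Ω : Set (EuclideanSpace ℝ (Fin N))} (i : Fin N) (w p : L2 Ω) : Prop :=
  ∀ φ : EuclideanSpace ℝ (Fin N) → ℝ, IsTestFunction Ω φ →
    ∫ x in Ω, w x * partialDeriv i φ x = - ∫ x in Ω, p x * φ x

section Linearity

variable {N : ℕ} {Ω : Set (EuclideanSpace ℝ (Fin N))}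

lemma IsTestFunction.memLp {φ : EuclideanSpace ℝ (Fin N) → ℝ} (h : IsTestFunction Ω φ) :
    MemLp φ 2 (volume.restrict Ω) :=
  (h.contDiff.continuous.memLp_of_hasCompactSupport h.hasCompactSupport).restrict Ω

lemma IsTestFunction.memLp_partialDeriv {φ : EuclideanSpace ℝ (Fin N) → ℝ}
    (h : IsTestFunction Ω φ) (i : Fin N) :
    MemLp (partialDeriv i φ) 2 (volume.restrict Ω) := by
  have hc : Continuous (partialDeriv i φ) :=
    (h.contDiff.continuous_fderiv (by simp)).clm_apply continuous_const
  have hs : HasCompactSupport (partialDeriv i φ) := h.hasCompactSupport.fderiv_apply ℝ _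
  exact (hc.memLp_of_hasCompactSupport hs).restrict Ω

lemma integrable_mul_of_memLp (w : L2 Ω) {φ : EuclideanSpace ℝ (Fin N) → ℝ}
    (h : MemLp φ 2 (volume.restrict Ω)) :
    Integrable (fun x => w x * φ x) (volume.restrict Ω) :=
  (Lp.memLp w).integrable_mul h

lemma integral_add_mul (w w' : L2 Ω) {φ : EuclideanSpace ℝ (Fin N) → ℝ}
    (h : MemLp φ 2 (volume.restrict Ω)) :
    ∫ x in Ω, (w + w' : L2 Ω) x * φ x =
      (∫ x in Ω, w x * φ x) + ∫ x in Ω, w' x * φ x := by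
  rw [← integral_add (integrable_mul_of_memLp w h) (integrable_mul_of_memLp w' h)]
  refine integral_congr_ae ?_
  filter_upwards [Lp.coeFn_add w w'] with x hx
  rw [hx, Pi.add_apply, add_mul]

lemma integral_smul_mul (c : ℝ) (w : L2 Ω) (φ : EuclideanSpace ℝ (Fin N) → ℝ) :
    ∫ x in Ω, (c • w : L2 Ω) x * φ x = c * ∫ x in Ω, w x * φ x := by
  rw [← integral_const_mul]
  refine integral_congr_ae ?_
  filter_upwards [Lp.coeFn_smul c w] with x hx
  simp [hx, mul_assoc]

lemma HasWeakDeriv.add {i : Fin N} {w w' p p' : L2 Ω} (h : HasWeakDeriv i w p)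
    (h' : HasWeakDeriv i w' p') : HasWeakDeriv i (w + w') (p + p') := by
  intro φ hφ
  rw [integral_add_mul _ _ (hφ.memLp_partialDeriv i), integral_add_mul _ _ hφ.memLp,
    h φ hφ, h' φ hφ]
  ring

lemma HasWeakDeriv.smul {i : Fin N} {w p : L2 Ω} (c : ℝ) (h : HasWeakDeriv i w p) :
    HasWeakDeriv i (c • w) (c • p) := by
  intro φ hφ
  rw [integral_smul_mul, integral_smul_mul, h φ hφ]
  ring

lemma HasWeakDeriv.zero (i : Fin N) : HasWeakDeriv i (0 : L2 Ω) 0 := by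
  intro φ hφ
  have h := integral_smul_mul 0 (0 : L2 Ω) (partialDeriv i φ)
  have h' := integral_smul_mul 0 (0 : L2 Ω) φ
  simp only [smul_zero, zero_mul] at h h'
  rw [h, h', neg_zero]

end Linearity

/-- The subspace of `L²(Ω) × L²(Ω)ᴺ` of the pairs `(w, ∇w)`. -/
def H1Graph {N : ℕ} (Ω : Set (EuclideanSpace ℝ (Fin N))) :
    Submodule ℝ (WithLp 2 (L2 Ω × PiLp 2 (fun _ : Fin N => L2 Ω))) where
  carrier := {z | ∀ i, HasWeakDeriv i z.fst (z.snd i)}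
  add_mem' h h' i := (h i).add (h' i)
  zero_mem' i := HasWeakDeriv.zero i
  smul_mem' c _ h i := (h i).smul c

/-- The Hilbert space `V = H¹(Ω)`: pairs `(w, ∇w)` of an `L²(Ω)` function and its weak gradient in
`L²(Ω)ᴺ`. The inherited inner product is `(w, z)_V = ∫ w z + ∑ᵢ ∫ ∂ᵢw ∂ᵢz`. -/
def H1 {N : ℕ} (Ω : Set (EuclideanSpace ℝ (Fin N))) : Type := H1Graph Ω

instance {N : ℕ} (Ω : Set (EuclideanSpace ℝ (Fin N))) : NormedAddCommGroup (H1 Ω) :=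
  Submodule.normedAddCommGroup (H1Graph Ω)

instance {N : ℕ} (Ω : Set (EuclideanSpace ℝ (Fin N))) : InnerProductSpace ℝ (H1 Ω) :=
  Submodule.innerProductSpace (H1Graph Ω)

/-- The embedding `V ↪ H`, i.e. the function underlying an element of `H¹(Ω)`. -/
def H1.toL2 {N : ℕ} {Ω : Set (EuclideanSpace ℝ (Fin N))} : H1 Ω →L[ℝ] L2 Ω :=
  (WithLp.fstL 2 ℝ (L2 Ω) (PiLp 2 (fun _ : Fin N => L2 Ω))).comp (H1Graph Ω).subtypeL

/-- The weak derivative `∂ᵢw` of `w ∈ H¹(Ω)`, as a bounded linear map in `w`. -/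
def H1.deriv {N : ℕ} {Ω : Set (EuclideanSpace ℝ (Fin N))} (i : Fin N) : H1 Ω →L[ℝ] L2 Ω :=
  (PiLp.proj 2 (fun _ : Fin N => L2 Ω) i).comp
    ((WithLp.sndL 2 ℝ (L2 Ω) (PiLp 2 (fun _ : Fin N => L2 Ω))).comp (H1Graph Ω).subtypeL)

lemma H1.hasWeakDeriv {N : ℕ} {Ω : Set (EuclideanSpace ℝ (Fin N))} (w : H1 Ω) (i : Fin N) :
    HasWeakDeriv i (H1.toL2 w) (H1.deriv i w) :=
  w.2 i

lemma H1.inner_eq {N : ℕ} {Ω : Set (EuclideanSpace ℝ (Fin N))} (w z : H1 Ω) :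
    ⟪w, z⟫_ℝ = ⟪H1.toL2 w, H1.toL2 z⟫_ℝ + ∑ i, ⟪H1.deriv i w, H1.deriv i z⟫_ℝ := by
  change ⟪w.1, z.1⟫_ℝ = _
  rw [WithLp.prod_inner_apply, PiLp.inner_apply]
  rfl

/-- The subspace of `H¹(Ω) × L²(Ω)ᴺˣᴺ` of the pairs `(w, D²w)`. -/
def H2Graph {N : ℕ} (Ω : Set (EuclideanSpace ℝ (Fin N))) :
    Submodule ℝ (WithLp 2 (H1 Ω × PiLp 2 (fun _ : Fin N × Fin N => L2 Ω))) where
  carrier := {z | ∀ i j, HasWeakDeriv j (H1.deriv i z.fst) (z.snd (i, j))}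
  add_mem' {a b} h h' i j := by
    simpa only [WithLp.add_fst, WithLp.add_snd, PiLp.add_apply, map_add] using
      (h i j).add (h' i j)
  zero_mem' i j := by
    simpa only [WithLp.zero_fst, WithLp.zero_snd, PiLp.zero_apply, map_zero] using
      HasWeakDeriv.zero (Ω := Ω) j
  smul_mem' c a h i j := by
    simpa only [WithLp.smul_fst, WithLp.smul_snd, PiLp.smul_apply, map_smul] using
      (h i j).smul c

/-- The Hilbert space `H²(Ω)`: pairs `(w, D²w)` of a function `w ∈ H¹(Ω)` and the matrix
of its weak second derivatives in `L²(Ω)`. -/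
def H2 {N : ℕ} (Ω : Set (EuclideanSpace ℝ (Fin N))) : Type := H2Graph Ω

instance {N : ℕ} (Ω : Set (EuclideanSpace ℝ (Fin N))) : NormedAddCommGroup (H2 Ω) :=
  Submodule.normedAddCommGroup (H2Graph Ω)

instance {N : ℕ} (Ω : Set (EuclideanSpace ℝ (Fin N))) : InnerProductSpace ℝ (H2 Ω) :=
  Submodule.innerProductSpace (H2Graph Ω)

/-- The embedding `H²(Ω) ↪ V`. -/
def H2.toH1 {N : ℕ} {Ω : Set (EuclideanSpace ℝ (Fin N))} : H2 Ω →L[ℝ] H1 Ω :=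
  (WithLp.fstL 2 ℝ (H1 Ω) (PiLp 2 (fun _ : Fin N × Fin N => L2 Ω))).comp (H2Graph Ω).subtypeL

/-- The embedding `H²(Ω) ↪ H`. -/
def H2.toL2 {N : ℕ} {Ω : Set (EuclideanSpace ℝ (Fin N))} : H2 Ω →L[ℝ] L2 Ω :=
  H1.toL2.comp H2.toH1

/-- The weak second derivative `∂ⱼ∂ᵢw ∈ L²(Ω)` of `w ∈ H²(Ω)`. -/
def H2.deriv2 {N : ℕ} {Ω : Set (EuclideanSpace ℝ (Fin N))} (i j : Fin N) : H2 Ω →L[ℝ] L2 Ω :=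
  (PiLp.proj 2 (fun _ : Fin N × Fin N => L2 Ω) (i, j)).comp
    ((WithLp.sndL 2 ℝ (H1 Ω) (PiLp 2 (fun _ : Fin N × Fin N => L2 Ω))).comp
      (H2Graph Ω).subtypeL)

lemma H2.hasWeakDeriv {N : ℕ} {Ω : Set (EuclideanSpace ℝ (Fin N))} (w : H2 Ω) (i j : Fin N) :
    HasWeakDeriv j (H1.deriv i (H2.toH1 w)) (H2.deriv2 i j w) :=
  w.2 i j

/-- The Laplacian `Δw = ∑ᵢ ∂ᵢ∂ᵢw ∈ L²(Ω)` of `w ∈ H²(Ω)`. -/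
def H2.laplacian {N : ℕ} {Ω : Set (EuclideanSpace ℝ (Fin N))} : H2 Ω →L[ℝ] L2 Ω :=
  ∑ i, H2.deriv2 i i

/-- The normal derivative `∂_ν w` on `∂Ω` of `w ∈ H²(Ω)`, as the functional
`v ↦ ∫_{∂Ω} (∂_ν w) v = ∫_Ω ∇w · ∇v + ∫_Ω (Δw) v` of `v ∈ H¹(Ω)`. -/
def H2.normalDeriv {N : ℕ} {Ω : Set (EuclideanSpace ℝ (Fin N))} (w : H2 Ω) (v : H1 Ω) : ℝ :=
  (∑ i, ⟪H1.deriv i (H2.toH1 w), H1.deriv i v⟫_ℝ) + ⟪H2.laplacian w, H1.toL2 v⟫_ℝ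

/-- The space `W = {z ∈ H²(Ω) | ∂_ν z = 0 on ∂Ω}`, with the norm of `H²(Ω)`. -/
def W {N : ℕ} (Ω : Set (EuclideanSpace ℝ (Fin N))) : Submodule ℝ (H2 Ω) where
  carrier := {z | ∀ v : H1 Ω, H2.normalDeriv z v = 0}
  add_mem' {a b} ha hb v := by
    have h : H2.normalDeriv (a + b) v = H2.normalDeriv a v + H2.normalDeriv b v := by
      simp only [H2.normalDeriv, map_add, inner_add_left, Finset.sum_add_distrib]
      ring
    rw [h, ha v, hb v, add_zero]
  zero_mem' v := by simp [H2.normalDeriv]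
  smul_mem' c a ha v := by
    have h : H2.normalDeriv (c • a) v = c * H2.normalDeriv a v := by
      simp only [H2.normalDeriv, map_smul, real_inner_smul_left, ← Finset.mul_sum]
      ring
    rw [h, ha v, mul_zero]

/-- The embedding `W ↪ H`. -/
def W.toL2 {N : ℕ} {Ω : Set (EuclideanSpace ℝ (Fin N))} (w : W Ω) : L2 Ω := H2.toL2 w.1

/-- The operator `-Δ + I : W → H`. -/
def W.negLaplacianAddOne {N : ℕ} {Ω : Set (EuclideanSpace ℝ (Fin N))} (w : W Ω) : L2 Ω :=
  W.toL2 w - H2.laplacian w.1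

/-- The dual `V*` of `V`. The dual norm is the norm of the inner product
`(v₁*, v₂*)_{V*} = ⟨v₁*, F⁻¹v₂*⟩` given by the Riesz isomorphism `F : V → V*`. -/
abbrev VStar {N : ℕ} (Ω : Set (EuclideanSpace ℝ (Fin N))) : Type := StrongDual ℝ (H1 Ω)

/-- The embedding `H ↪ V*`, `⟨h, z⟩_{V*, V} = (h, z)_H`. -/
def toVStar {N : ℕ} {Ω : Set (EuclideanSpace ℝ (Fin N))} (h : L2 Ω) : VStar Ω :=
  (innerSL ℝ h).comp H1.toL2

/-! ## Functions of time -/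

/-- Lebesgue measure on `(0, T)`. -/
abbrev timeMeasure (T : ℝ) : Measure ℝ := volume.restrict (Ioo 0 T)

/-- `u ∈ L^p(0, T; Y)` for an `H`-valued function `u` and a normed space `Y`
embedded in `H` by `j`. -/
def MemLpTime {N : ℕ} {Ω : Set (EuclideanSpace ℝ (Fin N))} {Y : Type} [NormedAddCommGroup Y]
    (T : ℝ) (p : ℝ≥0∞) (j : Y → L2 Ω) (u : ℝ → L2 Ω) : Prop :=
  ∃ v : ℝ → Y, MemLp v p (timeMeasure T) ∧ ∀ᵐ t ∂timeMeasure T, j (v t) = u t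

/-- `U ∈ H¹(0, T; X)` with derivative `U' ∈ L²(0, T; X)`, where `U` denotes the
absolutely continuous representative, defined at every `t ∈ [0, T]`. -/
def HasTimeDeriv {X : Type} [NormedAddCommGroup X] [NormedSpace ℝ X] [CompleteSpace X]
    (T : ℝ) (U U' : ℝ → X) : Prop :=
  MemLp U' 2 (timeMeasure T) ∧ ∀ t ∈ Icc 0 T, U t = U 0 + ∫ s in (0 : ℝ)..t, U' s

/-! ## Data -/

/-- Condition on `β` and its primitive `βhat`. Since `βhat` is convex, nonnegative, finite and
differentiable with derivative `β` on all of `ℝ`, automatically `β = ∂βhat` is a single-valued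
maximal monotone function with `β 0 = 0`. -/
structure CondBeta {N : ℕ} (Ω : Set (EuclideanSpace ℝ (Fin N))) (β βhat : ℝ → ℝ) (c₁ : ℝ) :
    Prop where
  convexOn : ConvexOn ℝ univ βhat
  hasDerivAt : ∀ r, HasDerivAt βhat (β r) r
  map_zero : βhat 0 = 0
  c₁_pos : 0 < c₁
  lower_bound : ∀ r, c₁ * |r| ^ 2 ≤ βhat r
  locallyIntegrable : ∀ z : EuclideanSpace ℝ (Fin N) → ℝ, MemLp z 2 (volume.restrict Ω) →
    Integrable (fun x => βhat (z x)) (volume.restrict Ω) →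
    LocallyIntegrableOn (fun x => β (z x)) Ω volume
  integrable_add : ∀ z ψ : EuclideanSpace ℝ (Fin N) → ℝ, MemLp z 2 (volume.restrict Ω) →
    IsTestFunction Ω ψ →
    Integrable (fun x => βhat (z x)) (volume.restrict Ω) →
    Integrable (fun x => βhat (z x + ψ x)) (volume.restrict Ω)

/-- `g ∈ L²(0, T; L²(Ω))`, and `f ∈ L²(0, T; H²(Ω))` solves `(-Δ + 1) f(t) = g(t)` a.e. in `Ω`,
`∂_ν f(t) = 0` on `∂Ω`, for a.a. `t ∈ (0, T)`. -/
structure CondSource {N : ℕ} {Ω : Set (EuclideanSpace ℝ (Fin N))} (T : ℝ)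
    (g : ℝ → L2 Ω) (f : ℝ → H2 Ω) : Prop where
  memLp_g : MemLp g 2 (timeMeasure T)
  memLp_f : MemLp f 2 (timeMeasure T)
  neumann : ∀ᵐ t ∂timeMeasure T, f t ∈ W Ω
  equation : ∀ᵐ t ∂timeMeasure T, H2.toL2 (f t) - H2.laplacian (f t) = g t

/-- The condition `βhat(u₀) ∈ L¹(Ω)` on the initial value `u₀ ∈ L²(Ω)` of the limit problem. -/
def CondInit {N : ℕ} {Ω : Set (EuclideanSpace ℝ (Fin N))} (βhat : ℝ → ℝ) (u₀ : L2 Ω) : Prop :=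
  Integrable (fun x => βhat (u₀ x)) (volume.restrict Ω)

/-- Condition on the family `(π_ε)`, `ε ∈ (0, 1]`, with constants `c₂(ε)`. -/
structure CondPi (P : ℝ → ℝ → ℝ) (c₂ : ℝ → ℝ) (c₁ : ℝ) : Prop where
  lipschitz : ∀ ε ∈ Ioc (0 : ℝ) 1, ∃ K, LipschitzWith K (P ε)
  map_zero : ∀ ε ∈ Ioc (0 : ℝ) 1, P ε 0 = 0
  c₂_pos : ∀ ε ∈ Ioc (0 : ℝ) 1, 0 < c₂ ε
  c₂_lt : ∃ εbar ∈ Ioc (0 : ℝ) 1, ∀ ε ∈ Ioc 0 εbar, c₂ ε < 2 * c₁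
  deriv_bound : ∀ ε ∈ Ioc (0 : ℝ) 1, eLpNorm (deriv (P ε)) ∞ volume ≤ ENNReal.ofReal (c₂ ε)
  convexOn : ∀ ε ∈ Ioc (0 : ℝ) 1,
    ConvexOn ℝ univ (fun r => ε / 2 * r ^ 2 + ∫ s in (0 : ℝ)..r, P ε s)

/-- Condition on the initial values `u₀ε ∈ H¹(Ω)`, `ε ∈ (0, 1]`, with constants `c₃(ε)`. -/
structure CondInitEps {N : ℕ} {Ω : Set (EuclideanSpace ℝ (Fin N))} (βhat : ℝ → ℝ)
    (u₀ε : ℝ → H1 Ω) (c₃ : ℝ → ℝ) : Prop where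
  c₃_pos : ∀ ε ∈ Ioc (0 : ℝ) 1, 0 < c₃ ε
  integrable : ∀ ε ∈ Ioc (0 : ℝ) 1,
    Integrable (fun x => βhat (H1.toL2 (u₀ε ε) x)) (volume.restrict Ω)
  norm_L2 : ∀ ε ∈ Ioc (0 : ℝ) 1, ‖H1.toL2 (u₀ε ε)‖ ^ 2 ≤ c₃ ε
  integral_le : ∀ ε ∈ Ioc (0 : ℝ) 1, ∫ x in Ω, βhat (H1.toL2 (u₀ε ε) x) ≤ c₃ ε
  norm_H1 : ∀ ε ∈ Ioc (0 : ℝ) 1, ε * ‖u₀ε ε‖ ^ 2 ≤ c₃ ε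

/-! ## Weak solutions -/

/-- `(u, μ)` is a weak solution of
`∂ₜu + (-Δ + 1)β(u) = g` in `Ω × (0, T)`, `∂_ν β(u) = 0` on `∂Ω × (0, T)`, `u(0) = u₀` in `Ω`,
where `g = (-Δ + 1) f`. Here `u` is the representative that is continuous with values in `V*`;
its values at every `t ∈ [0, T]` are in `H`, as `u ∈ L^∞(0, T; H)`. -/
structure IsWeakSolution {N : ℕ} {Ω : Set (EuclideanSpace ℝ (Fin N))} (T : ℝ) (β : ℝ → ℝ)
    (f : ℝ → H2 Ω) (u₀ : L2 Ω) (u : ℝ → L2 Ω) (μ : ℝ → H1 Ω) : Prop where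
  memLp_u : MemLp u ∞ (timeMeasure T)
  memLp_μ : MemLp μ 2 (timeMeasure T)
  evolution : ∃ u' : ℝ → VStar Ω, HasTimeDeriv T (fun t => toVStar (u t)) u' ∧
    ∀ᵐ t ∂timeMeasure T, ∀ z : H1 Ω, u' t z + ⟪μ t, z⟫_ℝ = 0
  potential : ∀ᵐ t ∂timeMeasure T, ∀ᵐ x ∂volume.restrict Ω,
    H1.toL2 (μ t) x = β (u t x) - H2.toL2 (f t) x
  initial : u 0 = u₀

/-- `(u, μ)` is a weak solution of
`∂ₜu + (-Δ + 1)μ = 0`, `μ = ε(-Δ + 1)u + β(u) + π_ε(u) - f` in `Ω × (0, T)`,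
`∂_ν μ = ∂_ν u = 0` on `∂Ω × (0, T)`, `u(0) = u₀ε` in `Ω`; `P` is the function `π_ε`. Again `u`
is the representative that is continuous with values in `V*`. -/
structure IsWeakSolutionEps {N : ℕ} {Ω : Set (EuclideanSpace ℝ (Fin N))} (T ε : ℝ)
    (β P : ℝ → ℝ) (f : ℝ → H2 Ω) (u₀ε : H1 Ω) (u : ℝ → L2 Ω) (μ : ℝ → H1 Ω) : Prop where
  memLp_V : MemLpTime T ∞ (H1.toL2 : H1 Ω → L2 Ω) u
  memLp_W : MemLpTime T 2 (W.toL2 : W Ω → L2 Ω) u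
  memLp_μ : MemLp μ 2 (timeMeasure T)
  evolution : ∃ u' : ℝ → VStar Ω, HasTimeDeriv T (fun t => toVStar (u t)) u' ∧
    ∀ᵐ t ∂timeMeasure T, ∀ z : H1 Ω, u' t z + ⟪μ t, z⟫_ℝ = 0
  potential : ∀ᵐ t ∂timeMeasure T, ∀ w : W Ω, W.toL2 w = u t →
    ∀ᵐ x ∂volume.restrict Ω,
      H1.toL2 (μ t) x =
        ε * W.negLaplacianAddOne w x + β (u t x) + P (u t x) - H2.toL2 (f t) x
  initial : u 0 = H1.toL2 u₀ε

end QuasilinearParabolic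

end

/-!
# Error estimate for an approximation of a quasilinear parabolic equation

Write `A = -Δ + 1` for the Neumann operator `W → H`, and `ι : V → H` for the embedding, so that the
norm of `h ∈ H` in `V*` is the norm of `ι† h` in `V`. Subtracting the two evolution equations, the
source `f` cancels, and testing with the Riesz representative of `u_ε - u` gives

`½ ‖u_ε - u‖²_{V*} + ∫ (β(u_ε) - β(u), u_ε - u)_H
  = ½ ‖u_{0ε} - u₀‖²_{V*} - ∫ (ε A u_ε + π_ε(u_ε), u_ε - u)_H`.

Here `(A u_ε, u_ε)_H ≥ 0`, and `ε (A u_ε, u)_H` and the `π_ε` term are `O(ε^{1/2})` once `u_ε` and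
`ε^{1/2} A u_ε` are bounded in `L^∞(0, T; H)` and `L²(0, T; H)` uniformly in `ε` (`error_estimate`).
The bound on `u` has to be independent of the weak solution, and this follows from uniqueness
(`IsWeakSolution.unique`), proved by the same test.

The uniform bounds (`IsWeakSolutionEps.apriori`) come from testing the approximate equation with
`u_ε`. Two points need work. Since `u_ε'` only takes values in `V*`, the energy inequality for
`‖u_ε‖²_H` is proved by regularising the quadratic form with the resolvent of `ι† ι`, for which the
product rule holds (`norm_sq_le_of_primitive`). And the term with `β` has the right sign,
`(β(w), A w)_H ≥ 0` for `w ∈ W` (`integral_comp_mul_nonneg`): for a `C¹` function `γ` in place of `β`,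
with `γ' ≥ 0` bounded, Green's formula and the chain rule for weak derivatives (`weakDeriv_comp`,
by mollification) turn it into `∫ γ'(w) |∇w|² + γ(w) w`; averages reduce monotone Lipschitz functions
to this case, and Yosida approximations reduce `β` to monotone Lipschitz functions.
-/

open MeasureTheory Set Filter Topology
open scoped ContDiff ENNReal InnerProductSpace

noncomputable section

namespace QuasilinearParabolic

/-! ### Inner products of primitives -/

lemma absolutelyContinuousOnInterval_of_dist_le {X Y : Type*} [PseudoMetricSpace X]
    [PseudoMetricSpace Y] {f : ℝ → X} {g : ℝ → Y} {a b : ℝ} (C : ℝ)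
    (hg : AbsolutelyContinuousOnInterval g a b)
    (h : ∀ s ∈ uIcc a b, ∀ t ∈ uIcc a b, dist (f s) (f t) ≤ C * dist (g s) (g t)) :
    AbsolutelyContinuousOnInterval f a b := by
  have hC := Tendsto.const_mul C hg
  rw [mul_zero] at hC
  refine squeeze_zero' (Eventually.of_forall fun _ => Finset.sum_nonneg fun _ _ => dist_nonneg)
    ?_ hC
  have hm : ∀ᶠ E : ℕ × (ℕ → ℝ × ℝ) in AbsolutelyContinuousOnInterval.totalLengthFilter ⊓
      𝓟 (AbsolutelyContinuousOnInterval.disjWithin a b),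
      E ∈ AbsolutelyContinuousOnInterval.disjWithin a b :=
    eventually_inf_principal.mpr (Eventually.of_forall fun _ hE => hE)
  filter_upwards [hm] with E hE
  rw [Finset.mul_sum]
  exact Finset.sum_le_sum fun i hi => h _ (hE.1 i hi).1 _ (hE.1 i hi).2

lemma intervalIntegrable_of_mem_Icc {Y : Type*} [NormedAddCommGroup Y] {F : ℝ → Y} {a b s t : ℝ}
    (hF : IntervalIntegrable F volume a b) (hs : s ∈ Icc a b) (ht : t ∈ Icc a b) :
    IntervalIntegrable F volume s t := by
  refine hF.mono_set ?_
  rw [uIcc_of_le (hs.1.trans hs.2)]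
  exact uIcc_subset_Icc hs ht

lemma intervalIntegrable_of_timeMeasure {Y : Type*} [NormedAddCommGroup Y] {F : ℝ → Y}
    {T s t : ℝ} (hF : Integrable F (timeMeasure T)) (hs : s ∈ Icc 0 T) (ht : t ∈ Icc 0 T) :
    IntervalIntegrable F volume s t := by
  refine intervalIntegrable_of_mem_Icc ?_ hs ht
  rwa [intervalIntegrable_iff_integrableOn_Ioo_of_le (hs.1.trans hs.2)]

section Primitive

variable {X : Type*} [NormedAddCommGroup X] [InnerProductSpace ℝ X] [CompleteSpace X]

/-- The product rule, integrated, for primitives of Bochner integrable functions. -/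
lemma inner_primitive_sub {a b : ℝ} (hab : a ≤ b) {U' V' : ℝ → X}
    (hU : IntervalIntegrable U' volume a b) (hV : IntervalIntegrable V' volume a b) (x y : X) :
    ⟪x + ∫ r in a..b, U' r, y + ∫ r in a..b, V' r⟫_ℝ - ⟪x, y⟫_ℝ =
      ∫ s in a..b, (⟪x + ∫ r in a..s, U' r, V' s⟫_ℝ + ⟪U' s, y + ∫ r in a..s, V' r⟫_ℝ) := by
  set G : ℝ → ℝ := fun s => ∫ r in a..s, (‖U' r‖ + ‖V' r‖) with hG
  have hGi : IntervalIntegrable (fun r => ‖U' r‖ + ‖V' r‖) volume a b := hU.norm.add hV.norm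
  have haI : a ∈ Icc a b := ⟨le_rfl, hab⟩
  have hbI : b ∈ Icc a b := ⟨hab, le_rfl⟩
  have hdiff : ∀ {F : ℝ → X}, IntervalIntegrable F volume a b → (∀ r, ‖F r‖ ≤ ‖U' r‖ + ‖V' r‖) →
      ∀ s ∈ Icc a b, ∀ t ∈ Icc a b,
      ‖(∫ r in a..t, F r) - ∫ r in a..s, F r‖ ≤ dist (G s) (G t) := by
    intro F hF hle s hs t ht
    rw [intervalIntegral.integral_interval_sub_left (intervalIntegrable_of_mem_Icc hF haI ht)
      (intervalIntegrable_of_mem_Icc hF haI hs),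
      dist_comm, Real.dist_eq, hG]
    simp only
    rw [intervalIntegral.integral_interval_sub_left (intervalIntegrable_of_mem_Icc hGi haI ht)
      (intervalIntegrable_of_mem_Icc hGi haI hs)]
    exact intervalIntegral.norm_integral_le_abs_of_norm_le (Eventually.of_forall hle)
      (intervalIntegrable_of_mem_Icc hGi hs ht)
  have hUd := hdiff hU fun r => le_add_of_nonneg_right (norm_nonneg _)
  have hVd := hdiff hV fun r => le_add_of_nonneg_left (norm_nonneg _)
  have hGac : AbsolutelyContinuousOnInterval G a b :=
    hGi.absolutelyContinuousOnInterval_intervalIntegral (by simp)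
  obtain ⟨M, hM⟩ := hGac.exists_bound
  rw [uIcc_of_le hab] at hM
  have hGa : G a = 0 := by simp [hG]
  have hbd : ∀ {F : ℝ → X} (z : X), (∀ s ∈ Icc a b, ∀ t ∈ Icc a b,
      ‖(∫ r in a..t, F r) - ∫ r in a..s, F r‖ ≤ dist (G s) (G t)) →
      ∀ s ∈ Icc a b, ‖z + ∫ r in a..s, F r‖ ≤ ‖z‖ + M := by
    intro F z hF s hs
    have h := hF a haI s hs
    rw [intervalIntegral.integral_same, sub_zero, hGa, dist_zero_left] at h
    exact (norm_add_le _ _).trans (add_le_add le_rfl (h.trans (hM s hs)))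
  set φ : ℝ → ℝ := fun s => ⟪x + ∫ r in a..s, U' r, y + ∫ r in a..s, V' r⟫_ℝ with hφ
  have hφac : AbsolutelyContinuousOnInterval φ a b := by
    refine absolutelyContinuousOnInterval_of_dist_le ((‖y‖ + M) + (‖x‖ + M)) hGac ?_
    rw [uIcc_of_le hab]
    intro s hs t ht
    have e : φ t - φ s = ⟪(∫ r in a..t, U' r) - ∫ r in a..s, U' r, y + ∫ r in a..t, V' r⟫_ℝ +
        ⟪x + ∫ r in a..s, U' r, (∫ r in a..t, V' r) - ∫ r in a..s, V' r⟫_ℝ := by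
      simp only [hφ, inner_add_left, inner_add_right, inner_sub_left, inner_sub_right]
      ring
    rw [dist_comm, Real.dist_eq, e, add_mul]
    refine (abs_add_le _ _).trans (add_le_add ?_ ?_)
    · refine (abs_real_inner_le_norm _ _).trans ?_
      rw [mul_comm]
      exact mul_le_mul (hbd y hVd t ht) (hUd s hs t ht) (norm_nonneg _)
        ((norm_nonneg _).trans (hbd y hVd t ht))
    · refine (abs_real_inner_le_norm _ _).trans ?_
      exact mul_le_mul (hbd x hUd s hs) (hVd s hs t ht) (norm_nonneg _)
        ((norm_nonneg _).trans (hbd x hUd s hs))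
  have hφa : φ a = ⟪x, y⟫_ℝ := by simp [hφ]
  change φ b - _ = _
  rw [← hφa, ← hφac.integral_deriv_eq_sub]
  refine intervalIntegral.integral_congr_ae ?_
  filter_upwards [hU.ae_hasDerivAt_integral, hV.ae_hasDerivAt_integral] with s h1 h2 hs
  have hs' := uIoc_subset_uIcc hs
  exact (((h1 hs' a (by simp)).const_add x).inner ℝ ((h2 hs' a (by simp)).const_add y)).deriv

end Primitive

lemma integrable_inner_of_memLp_two {α E : Type*} [MeasurableSpace α] {ν : Measure α}
    [NormedAddCommGroup E] [InnerProductSpace ℝ E] {f g : α → E} (hf : MemLp f 2 ν)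
    (hg : MemLp g 2 ν) : Integrable (fun x => ⟪f x, g x⟫_ℝ) ν := by
  refine (hf.norm.integrable_mul hg.norm).mono' (hf.1.inner hg.1) (Eventually.of_forall fun x => ?_)
  exact norm_inner_le_norm _ _

/-! ### The resolvent of `ι† ι` and the energy inequality -/

section Energy

variable {V H : Type*} [NormedAddCommGroup V] [InnerProductSpace ℝ V] [CompleteSpace V]
  [NormedAddCommGroup H] [InnerProductSpace ℝ H] [CompleteSpace H]

open ContinuousLinearMap in
/-- By the Lax–Milgram theorem, `δ² + ι† ι` is invertible on `V`. -/
lemma exists_resolvent (ι : V →L[ℝ] H) {δ : ℝ} (hδ : 0 < δ) :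
    ∃ L : V →L[ℝ] V, (∀ x, δ ^ 2 • L x + adjoint ι (ι (L x)) = x) ∧
      ∀ x, δ ^ 2 • L x + L (adjoint ι (ι x)) = x := by
  let A : V →L[ℝ] V := δ ^ 2 • ContinuousLinearMap.id ℝ V + (adjoint ι).comp ι
  let B : V →L[ℝ] V →L[ℝ] ℝ := (innerSL ℝ).comp A
  have hB : IsCoercive B := by
    refine ⟨δ ^ 2, by positivity, fun u => ?_⟩
    have e : B u u = δ ^ 2 * ‖u‖ * ‖u‖ + ‖ι u‖ ^ 2 := by
      change ⟪δ ^ 2 • u + adjoint ι (ι u), u⟫_ℝ = _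
      rw [inner_add_left, adjoint_inner_left, real_inner_smul_left, real_inner_self_eq_norm_sq,
        real_inner_self_eq_norm_sq]
      ring
    rw [e]
    exact le_add_of_nonneg_right (sq_nonneg _)
  let E := hB.continuousLinearEquivOfBilin
  have hE : ∀ v, E v = A v := by
    intro v
    refine ext_inner_right ℝ fun w => ?_
    exact hB.continuousLinearEquivOfBilin_apply v w
  refine ⟨E.symm, fun x => ?_, fun x => ?_⟩
  · have h := E.apply_symm_apply x
    rw [hE] at h
    exact h
  · have h := E.symm_apply_apply x
    rw [hE] at h
    simpa [A] using h

open ContinuousLinearMap in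
/-- `L = (δ² + ι† ι)⁻¹` is a selfadjoint regularisation of `(ι† ι)⁻¹`. The form `⟪L x, x⟫`, which is
continuous on `V`, is at most `‖h‖²` at `x = ι† h`, and by the last bound it tends to `‖h‖²` as
`δ → 0` if `h` is in the range of `ι`. -/
lemma resolvent_properties {ι : V →L[ℝ] H} {δ : ℝ} (hδ : 0 < δ) {L : V →L[ℝ] V}
    (hL : ∀ x, δ ^ 2 • L x + adjoint ι (ι (L x)) = x) :
    (∀ x y, ⟪L x, y⟫_ℝ = ⟪x, L y⟫_ℝ) ∧
    (∀ h, ⟪L (adjoint ι h), adjoint ι h⟫_ℝ ≤ ‖h‖ ^ 2) ∧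
    (∀ a, δ ^ 2 * ‖L (adjoint ι a)‖ ≤ δ * ‖a‖) ∧
    ∀ v, δ ^ 2 * ‖ι (L v)‖ ≤ δ * ‖v‖ := by
  have key : ∀ x, δ ^ 2 * ‖L x‖ ^ 2 + ‖ι (L x)‖ ^ 2 = ⟪x, L x⟫_ℝ := by
    intro x
    nth_rewrite 3 [← hL x]
    rw [inner_add_left, adjoint_inner_left, real_inner_smul_left, real_inner_self_eq_norm_sq,
      real_inner_self_eq_norm_sq]
  have key' : ∀ h, δ ^ 2 * ‖L (adjoint ι h)‖ ^ 2 + ‖ι (L (adjoint ι h))‖ ^ 2 ≤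
      ‖h‖ * ‖ι (L (adjoint ι h))‖ := by
    intro h
    rw [key, adjoint_inner_left]
    exact real_inner_le_norm _ _
  have hι : ∀ h, ‖ι (L (adjoint ι h))‖ ≤ ‖h‖ := by
    intro h
    by_contra! hlt
    have := key' h
    nlinarith [norm_nonneg h, mul_nonneg (sq_nonneg δ) (sq_nonneg ‖L (adjoint ι h)‖)]
  refine ⟨fun x y => ?_, fun h => ?_, fun a => ?_, fun v => ?_⟩
  · nth_rewrite 1 [← hL y]
    nth_rewrite 2 [← hL x]
    rw [inner_add_left, inner_add_right, adjoint_inner_left, adjoint_inner_right,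
      real_inner_smul_left, real_inner_smul_right]
  · rw [adjoint_inner_right]
    refine (real_inner_le_norm _ _).trans ?_
    rw [sq]
    exact mul_le_mul_of_nonneg_right (hι h) (norm_nonneg _)
  · have h1 : (δ * ‖L (adjoint ι a)‖) ^ 2 ≤ ‖a‖ ^ 2 := by
      nlinarith [key' a, hι a, norm_nonneg a, sq_nonneg ‖ι (L (adjoint ι a))‖]
    have h2 := abs_le_of_sq_le_sq' h1 (norm_nonneg _)
    nlinarith [h2.2]
  · have h0 := (key v).trans_le (real_inner_le_norm v (L v))
    have h1 : δ ^ 2 * ‖L v‖ ≤ ‖v‖ := by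
      by_contra! hlt
      have hpos : 0 < ‖L v‖ := by
        by_contra! hle
        have : ‖L v‖ = 0 := le_antisymm hle (norm_nonneg _)
        rw [this, mul_zero] at hlt
        exact absurd hlt (not_lt.2 (norm_nonneg _))
      nlinarith [sq_nonneg ‖ι (L v)‖, mul_lt_mul_of_pos_right hlt hpos]
    have h2 : (δ * ‖ι (L v)‖) ^ 2 ≤ ‖v‖ ^ 2 := by
      have h3 : ‖ι (L v)‖ ^ 2 ≤ ‖v‖ * ‖L v‖ := by
        nlinarith [mul_nonneg (sq_nonneg δ) (sq_nonneg ‖L v‖)]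
      calc (δ * ‖ι (L v)‖) ^ 2 = δ ^ 2 * ‖ι (L v)‖ ^ 2 := by ring
        _ ≤ δ ^ 2 * (‖v‖ * ‖L v‖) := mul_le_mul_of_nonneg_left h3 (sq_nonneg _)
        _ = ‖v‖ * (δ ^ 2 * ‖L v‖) := by ring
        _ ≤ ‖v‖ * ‖v‖ := mul_le_mul_of_nonneg_left h1 (norm_nonneg _)
        _ = ‖v‖ ^ 2 := by ring
    have h4 := abs_le_of_sq_le_sq' h2 (norm_nonneg _)
    nlinarith [h4.2]

open ContinuousLinearMap in
/-- Let `ι† u` be a primitive of `U' ∈ L²(0, T; V)`. Then `‖ι† u‖²` satisfies the chain rule. -/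
lemma norm_sq_adjoint_primitive (ι : V →L[ℝ] H) {T : ℝ} {u : ℝ → H} {U' : ℝ → V}
    (hU' : MemLp U' 2 (timeMeasure T))
    (hu : ∀ t ∈ Icc 0 T, adjoint ι (u t) = adjoint ι (u 0) + ∫ s in (0 : ℝ)..t, U' s)
    {t : ℝ} (ht : t ∈ Icc 0 T) :
    ‖adjoint ι (u t)‖ ^ 2 =
      ‖adjoint ι (u 0)‖ ^ 2 + 2 * ∫ s in (0 : ℝ)..t, ⟪u s, ι (U' s)⟫_ℝ := by
  have hT : 0 ≤ T := ht.1.trans ht.2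
  have hint : IntervalIntegrable U' volume 0 t :=
    intervalIntegrable_of_timeMeasure (hU'.integrable (by norm_num)) ⟨le_rfl, hT⟩ ht
  have h := inner_primitive_sub ht.1 hint hint (adjoint ι (u 0)) (adjoint ι (u 0))
  rw [← hu t ht, real_inner_self_eq_norm_sq, real_inner_self_eq_norm_sq] at h
  rw [← intervalIntegral.integral_const_mul, eq_add_of_sub_eq' h]
  congr 1
  refine intervalIntegral.integral_congr fun s hs => ?_
  rw [uIcc_of_le ht.1] at hs
  have h2 := hu s ⟨hs.1, hs.2.trans ht.2⟩
  rw [← h2, adjoint_inner_left, adjoint_inner_right, real_inner_comm (u s)]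
  ring

open ContinuousLinearMap in
/-- The energy inequality for `‖u‖²`, where `ι† u` is a primitive of `U'` and, at almost all times,
`u = ι v` with `v = ι† a`: formally `d/dt ‖u‖² = 2 ⟪U', v⟫ = 2 ⟪ι U', a⟫`. -/
lemma norm_sq_le_of_primitive (ι : V →L[ℝ] H) {T : ℝ} {u : ℝ → H} {U' : ℝ → V} {a : ℝ → H}
    (hU' : MemLp U' 2 (timeMeasure T)) (ha : MemLp a 2 (timeMeasure T))
    (hu : ∀ t ∈ Icc 0 T, adjoint ι (u t) = adjoint ι (u 0) + ∫ s in (0 : ℝ)..t, U' s)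
    (hua : ∀ᵐ t ∂timeMeasure T, u t = ι (adjoint ι (a t))) :
    ∀ᵐ t ∂timeMeasure T,
      ‖u t‖ ^ 2 ≤ ‖u 0‖ ^ 2 + 2 * ∫ s in (0 : ℝ)..t, ⟪a s, ι (U' s)⟫_ℝ := by
  have hua' := (ae_restrict_iff' measurableSet_Ioo).1 hua
  filter_upwards [hua, ae_restrict_mem measurableSet_Ioo] with t hut htI
  have hT : 0 ≤ T := (htI.1.trans htI.2).le
  have ht : t ∈ Icc 0 T := ⟨htI.1.le, htI.2.le⟩
  have h0 : (0 : ℝ) ∈ Icc 0 T := ⟨le_rfl, hT⟩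
  have hint : IntervalIntegrable U' volume 0 t := 
    intervalIntegrable_of_timeMeasure (hU'.integrable (by norm_num)) h0 ht
  have hprod : IntervalIntegrable (fun s => ‖a s‖ * ‖U' s‖) volume 0 t :=
    intervalIntegrable_of_timeMeasure (ha.norm.integrable_mul hU'.norm) h0 ht
  have hinner : IntervalIntegrable (fun s => ⟪a s, ι (U' s)⟫_ℝ) volume 0 t :=
    intervalIntegrable_of_timeMeasure (integrable_inner_of_memLp_two ha (ι.comp_memLp' hU'))  h0 ht
  set C : ℝ := ‖adjoint ι (a t)‖ * ‖u t‖ + 2 * ∫ s in (0 : ℝ)..t, ‖a s‖ * ‖U' s‖ with hC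
  suffices h : ∀ δ > 0,
      ‖u t‖ ^ 2 ≤ ‖u 0‖ ^ 2 + 2 * (∫ s in (0 : ℝ)..t, ⟪a s, ι (U' s)⟫_ℝ) + δ * C by
    have hlim : Tendsto (fun δ : ℝ => ‖u 0‖ ^ 2 +
        2 * (∫ s in (0 : ℝ)..t, ⟪a s, ι (U' s)⟫_ℝ) + δ * C) (𝓝[>] 0)
        (𝓝 (‖u 0‖ ^ 2 + 2 * (∫ s in (0 : ℝ)..t, ⟪a s, ι (U' s)⟫_ℝ) + 0 * C)) :=
      (Continuous.tendsto (by fun_prop) 0).mono_left nhdsWithin_le_nhds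
    rw [zero_mul, add_zero] at hlim
    exact ge_of_tendsto hlim (eventually_mem_nhdsWithin.mono fun δ hδ => h δ hδ)
  intro δ hδ
  obtain ⟨L, hL1, hL2⟩ := exists_resolvent ι hδ
  obtain ⟨hsymm, hle, hb1, hb2⟩ := resolvent_properties hδ hL1
  have hLint : IntervalIntegrable (fun s => L (U' s)) volume 0 t :=
    intervalIntegrable_of_timeMeasure ((L.comp_memLp' hU').integrable (by norm_num)) h0 ht
  have hLa : IntervalIntegrable (fun s => ⟪L (adjoint ι (a s)), U' s⟫_ℝ) volume 0 t :=
    intervalIntegrable_of_timeMeasure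
      (integrable_inner_of_memLp_two (L.comp_memLp' ((adjoint ι).comp_memLp' ha)) hU') h0 ht
  have h := inner_primitive_sub ht.1 hLint hint (L (adjoint ι (u 0))) (adjoint ι (u 0))
  have hLu : ∀ s ∈ Icc 0 t, L (adjoint ι (u 0)) + ∫ r in (0 : ℝ)..s, L (U' r) =
      L (adjoint ι (u s)) := by
    intro s hs
    rw [hu s ⟨hs.1, hs.2.trans ht.2⟩, map_add, L.intervalIntegral_comp_comm]
    refine hint.mono_set ?_
    rw [uIcc_of_le ht.1, uIcc_of_le hs.1]
    exact Icc_subset_Icc le_rfl hs.2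
  rw [← hu t ht, hLu t ⟨ht.1, le_rfl⟩] at h
  -- the integrand is `2 ⟪a, ι U'⟫` up to a term of order `δ`
  have hmono : (∫ s in (0 : ℝ)..t, (⟪L (adjoint ι (u 0)) + ∫ r in (0 : ℝ)..s, L (U' r), U' s⟫_ℝ +
      ⟪L (U' s), adjoint ι (u 0) + ∫ r in (0 : ℝ)..s, U' r⟫_ℝ)) ≤
      ∫ s in (0 : ℝ)..t, (2 * ⟪a s, ι (U' s)⟫_ℝ + 2 * δ * (‖a s‖ * ‖U' s‖)) := by
    rw [intervalIntegral.integral_of_le ht.1, intervalIntegral.integral_of_le ht.1]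
    have hrhs := ((hinner.const_mul 2).add (hprod.const_mul (2 * δ))).1
    have hpt : ∀ᵐ s ∂volume.restrict (Ioc 0 t),
        (⟪L (adjoint ι (u 0)) + ∫ r in (0 : ℝ)..s, L (U' r), U' s⟫_ℝ +
        ⟪L (U' s), adjoint ι (u 0) + ∫ r in (0 : ℝ)..s, U' r⟫_ℝ) =
        2 * (⟪a s, ι (U' s)⟫_ℝ - δ ^ 2 * ⟪L (adjoint ι (a s)), U' s⟫_ℝ) := by
      rw [ae_restrict_iff' measurableSet_Ioc]
      filter_upwards [hua'] with s hs hsI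
      have hsT : s ∈ Ioo 0 T := ⟨hsI.1, hsI.2.trans_lt htI.2⟩
      rw [hLu s ⟨hsI.1.le, hsI.2⟩, ← hu s ⟨hsT.1.le, hsT.2.le⟩, hsymm (U' s),
        real_inner_comm _ (U' s), ← two_mul]
      have e : L (adjoint ι (u s)) = adjoint ι (a s) - δ ^ 2 • L (adjoint ι (a s)) := by
        rw [hs hsT]
        exact eq_sub_of_add_eq' (hL2 _)
      rw [e, inner_sub_left, adjoint_inner_left, real_inner_smul_left]
    refine (integral_congr_ae hpt).trans_le ?_
    refine integral_mono_ae (((hinner.sub (hLa.const_mul (δ ^ 2))).const_mul 2).1) hrhs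
      (Eventually.of_forall fun s => ?_)
    have h1 := neg_le_of_abs_le (abs_real_inner_le_norm (L (adjoint ι (a s))) (U' s))
    have h2 := mul_le_mul_of_nonneg_right (hb1 (a s)) (norm_nonneg (U' s))
    simp only
    nlinarith [mul_le_mul_of_nonneg_left h1 (sq_nonneg δ)]
  rw [← h, intervalIntegral.integral_add (hinner.const_mul 2) (hprod.const_mul (2 * δ)),
    intervalIntegral.integral_const_mul, intervalIntegral.integral_const_mul] at hmono
  -- the quadratic form at time `t` differs from `‖u t‖²` by a term of order `δ`
  have hlow : ‖u t‖ ^ 2 - δ * (‖adjoint ι (a t)‖ * ‖u t‖) ≤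
      ⟪L (adjoint ι (u t)), adjoint ι (u t)⟫_ℝ := by
    have e : L (adjoint ι (u t)) = adjoint ι (a t) - δ ^ 2 • L (adjoint ι (a t)) := by
      rw [hut]
      exact eq_sub_of_add_eq' (hL2 _)
    rw [adjoint_inner_right, e, map_sub, map_smul, ← hut, inner_sub_left,
      real_inner_self_eq_norm_sq, real_inner_smul_left]
    have h1 := real_inner_le_norm (ι (L (adjoint ι (a t)))) (u t)
    have h2 := mul_le_mul_of_nonneg_right (hb2 (adjoint ι (a t))) (norm_nonneg (u t))
    nlinarith [mul_le_mul_of_nonneg_left h1 (sq_nonneg δ)]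
  have h3 := hle (u 0)
  rw [hC]
  linarith

end Energy

/-! ### Mollification -/

section Mollify

open scoped Convolution
open ContinuousLinearMap (lsmul)

variable {N : ℕ}

/-- A bump function at the origin of `ℝᴺ` supported in the ball of radius `2 / (n + 2)`. -/
def mollifierBump (N n : ℕ) : ContDiffBump (0 : EuclideanSpace ℝ (Fin N)) where
  rIn := 1 / (n + 2)
  rOut := 2 / (n + 2)
  rIn_pos := by positivity
  rIn_lt_rOut := by gcongr; norm_num

/-- The mollification `ρₙ ⋆ g` of a function on `ℝᴺ`. -/
def mollify (n : ℕ) (g : EuclideanSpace ℝ (Fin N) → ℝ) : EuclideanSpace ℝ (Fin N) → ℝ :=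
  (mollifierBump N n).normed volume ⋆[lsmul ℝ ℝ, volume] g

lemma tendsto_mollifierBump_rOut : Tendsto (fun n => (mollifierBump N n).rOut) atTop (𝓝 0) := by
  change Tendsto (fun n : ℕ => (2 : ℝ) / (n + 2)) atTop (𝓝 0)
  exact tendsto_const_nhds.div_atTop (tendsto_natCast_atTop_atTop.atTop_add tendsto_const_nhds)

lemma ae_tendsto_mollify {g : EuclideanSpace ℝ (Fin N) → ℝ} (hg : LocallyIntegrable g volume) :
    ∀ᵐ x, Tendsto (fun n => mollify n g x) atTop (𝓝 (g x)) := by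
  refine ContDiffBump.ae_convolution_tendsto_right_of_locallyIntegrable (K := 2)
    tendsto_mollifierBump_rOut (Eventually.of_forall fun n => le_of_eq ?_) hg
  change (2 : ℝ) / (n + 2) = 2 * (1 / (n + 2))
  ring

lemma contDiff_mollify {g : EuclideanSpace ℝ (Fin N) → ℝ} (hg : LocallyIntegrable g volume)
    (n : ℕ) : ContDiff ℝ ∞ (mollify n g) :=
  (mollifierBump N n).hasCompactSupport_normed.contDiff_convolution_left _
    (mollifierBump N n).contDiff_normed hg

lemma integrable_mollify {g : EuclideanSpace ℝ (Fin N) → ℝ} (hg : Integrable g volume) (n : ℕ) :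
    Integrable (mollify n g) volume :=
  (mollifierBump N n).integrable_normed.integrable_convolution _ hg

lemma integral_norm_mollify_le {g : EuclideanSpace ℝ (Fin N) → ℝ} (hg : Integrable g volume)
    (n : ℕ) : ∫ x, ‖mollify n g x‖ ≤ ∫ x, ‖g x‖ := by
  have h := integral_convolution (lsmul ℝ ℝ) (ν := volume) (μ := volume)
    (mollifierBump N n).integrable_normed hg.norm
  rw [ContDiffBump.integral_normed] at h
  simp only [ContinuousLinearMap.lsmul_apply, one_smul] at h
  rw [← h]
  refine integral_mono (integrable_mollify hg n).norm (integrable_mollify hg.norm n) fun x => ?_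
  refine (norm_integral_le_integral_norm _).trans (le_of_eq ?_)
  refine integral_congr_ae (Eventually.of_forall fun t => ?_)
  simp [abs_of_nonneg ((mollifierBump N n).nonneg_normed t)]

/-- If `Fₙ → F` almost everywhere and `limsup ‖Fₙ‖₁ ≤ ‖F‖₁`, then `Fₙ → F` in `L¹`. -/
lemma tendsto_integral_norm_sub_of_ae {α : Type*} [MeasurableSpace α] {ν : Measure α}
    {F : ℕ → α → ℝ} {G : α → ℝ} (hF : ∀ n, Integrable (F n) ν) (hG : Integrable G ν)
    (hlim : ∀ᵐ x ∂ν, Tendsto (fun n => F n x) atTop (𝓝 (G x)))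
    (hle : ∀ n, ∫ x, ‖F n x‖ ∂ν ≤ ∫ x, ‖G x‖ ∂ν) :
    Tendsto (fun n => ∫ x, ‖F n x - G x‖ ∂ν) atTop (𝓝 0) := by
  -- `m n = ‖F n‖ + ‖G‖ - ‖F n - G‖` is dominated by `2 ‖G‖` and tends to it
  have hm : Tendsto (fun n => ∫ x, (‖F n x‖ + ‖G x‖ - ‖F n x - G x‖) ∂ν) atTop
      (𝓝 (∫ x, 2 * ‖G x‖ ∂ν)) := by
    refine tendsto_integral_of_dominated_convergence (fun x => 2 * ‖G x‖)
      (fun n => (((hF n).norm.add hG.norm).sub ((hF n).sub hG).norm).1) (hG.norm.const_mul 2)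
      (fun n => Eventually.of_forall fun x => ?_) ?_
    · have h1 := norm_sub_norm_le (F n x) (F n x - G x)
      have h2 := norm_sub_le (F n x) (G x)
      rw [sub_sub_cancel] at h1
      rw [Real.norm_eq_abs, abs_of_nonneg (by linarith)]
      linarith
    · filter_upwards [hlim] with x hx
      have h := (hx.norm.add_const ‖G x‖).sub (hx.sub_const (G x)).norm
      rwa [sub_self, norm_zero, sub_zero, ← two_mul] at h
  rw [integral_const_mul] at hm
  have h0 : Tendsto (fun n => 2 * (∫ x, ‖G x‖ ∂ν) -
      ∫ x, (‖F n x‖ + ‖G x‖ - ‖F n x - G x‖) ∂ν) atTop (𝓝 0) := by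
    simpa using hm.const_sub (2 * ∫ x, ‖G x‖ ∂ν)
  refine squeeze_zero (fun n => integral_nonneg fun x => norm_nonneg _) (fun n => ?_) h0
  have e : ∫ x, (‖F n x‖ + ‖G x‖ - ‖F n x - G x‖) ∂ν =
      (∫ x, ‖F n x‖ ∂ν) + (∫ x, ‖G x‖ ∂ν) - ∫ x, ‖F n x - G x‖ ∂ν := by
    rw [← integral_add (hF n).norm hG.norm]
    exact integral_sub ((hF n).norm.add hG.norm) ((hF n).sub hG).norm
  linarith [hle n]

lemma tendsto_setIntegral_norm_mollify_sub {g : EuclideanSpace ℝ (Fin N) → ℝ}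
    (hg : LocallyIntegrable g volume) {K : Set (EuclideanSpace ℝ (Fin N))} (hK : IsCompact K) :
    Tendsto (fun n => ∫ x in K, ‖mollify n g x - g x‖) atTop (𝓝 0) := by
  obtain ⟨R, hR⟩ := hK.isBounded.subset_closedBall 0
  set q := (Metric.closedBall (0 : EuclideanSpace ℝ (Fin N)) (R + 1)).indicator g with hq
  have hqi : Integrable q volume :=
    (integrable_indicator_iff Metric.isClosed_closedBall.measurableSet).2
      (hg.integrableOn_isCompact (isCompact_closedBall _ _))
  have h := tendsto_integral_norm_sub_of_ae (integrable_mollify hqi) hqi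
    (ae_tendsto_mollify hqi.locallyIntegrable) (integral_norm_mollify_le hqi)
  refine squeeze_zero' (Eventually.of_forall fun n => integral_nonneg fun x => norm_nonneg _) ?_ h
  filter_upwards [tendsto_mollifierBump_rOut.eventually (ge_mem_nhds zero_lt_one)] with n hn
  have hi := ((integrable_mollify hqi n).sub hqi).norm
  have e : ∫ x in K, ‖mollify n g x - g x‖ = ∫ x in K, ‖mollify n q x - q x‖ := by
    refine setIntegral_congr_fun hK.measurableSet fun x hx => ?_
    have hxR : ‖x‖ ≤ R := by simpa using hR hx
    have hqx : q x = g x := indicator_of_mem (by simp; linarith) _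
    have hmx : mollify n q x = mollify n g x := by
      refine integral_congr_ae (Eventually.of_forall fun t => ?_)
      by_cases ht : t ∈ Function.support ((mollifierBump N n).normed volume)
      · rw [ContDiffBump.support_normed_eq, mem_ball_zero_iff] at ht
        have hmem : x - t ∈ Metric.closedBall (0 : EuclideanSpace ℝ (Fin N)) (R + 1) := by
          rw [mem_closedBall_zero_iff]
          linarith [norm_sub_le x t]
        simp only [hq, indicator_of_mem hmem]
      · rw [Function.notMem_support] at ht
        simp [ht]
    simp only [hqx, hmx]
  rw [e]
  exact setIntegral_le_integral hi (Eventually.of_forall fun x => norm_nonneg _)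

/-- Where the ball of radius `rOut` lies in `Ω`, mollification commutes with weak derivatives. -/
lemma partialDeriv_mollify {Ω : Set (EuclideanSpace ℝ (Fin N))} {i : Fin N}
    {w p : EuclideanSpace ℝ (Fin N) → ℝ} (hw : LocallyIntegrable w volume)
    (hwp : ∀ φ, IsTestFunction Ω φ → ∫ x, w x * partialDeriv i φ x = - ∫ x, p x * φ x) {n : ℕ}
    {x : EuclideanSpace ℝ (Fin N)}
    (hx : Metric.closedBall x (mollifierBump N n).rOut ⊆ Ω) :
    partialDeriv i (mollify n w) x = mollify n p x := by
  set ρ := (mollifierBump N n).normed volume with hρ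
  have hρc : ContDiff ℝ ∞ ρ := (mollifierBump N n).contDiff_normed
  have hρs : HasCompactSupport ρ := (mollifierBump N n).hasCompactSupport_normed
  have hflip : ∀ g : EuclideanSpace ℝ (Fin N) → ℝ,
      mollify n g = g ⋆[(lsmul ℝ ℝ).flip, volume] ρ := fun g => (convolution_flip _).symm
  set φ : EuclideanSpace ℝ (Fin N) → ℝ := fun y => ρ (x - y) with hφ
  have hsub : ∀ y, HasFDerivAt (fun y : EuclideanSpace ℝ (Fin N) => x - y)
      (-ContinuousLinearMap.id ℝ _) y := fun y => (hasFDerivAt_id y).const_sub x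
  have hpd : ∀ y, partialDeriv i φ y = - partialDeriv i ρ (x - y) := by
    intro y
    have h := ((hρc.differentiable (by simp)) (x - y)).hasFDerivAt.comp y (hsub y)
    rw [partialDeriv, show fderiv ℝ φ y = _ from h.fderiv]
    simp [partialDeriv]
  have hφs : tsupport φ ⊆ Metric.closedBall x (mollifierBump N n).rOut := by
    refine closure_minimal (fun y hy => ?_) Metric.isClosed_closedBall
    have hy' : x - y ∈ Function.support ρ := hy
    rw [hρ, ContDiffBump.support_normed_eq, mem_ball_zero_iff] at hy'
    rw [Metric.mem_closedBall, dist_comm, dist_eq_norm]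
    exact hy'.le
  have hφt : IsTestFunction Ω φ :=
    ⟨hρc.comp (contDiff_const.sub contDiff_id),
      HasCompactSupport.of_support_subset_isCompact (isCompact_closedBall _ _)
        ((subset_tsupport φ).trans hφs), hφs.trans hx⟩
  have hd := hρs.hasFDerivAt_convolution_right (lsmul ℝ ℝ).flip hw (hρc.of_le (by simp)) x
  rw [partialDeriv, hflip, hd.fderiv, convolution_precompR_apply _ hw (hρs.fderiv ℝ)
    (hρc.continuous_fderiv (by simp)), hflip]
  have h1 := hwp φ hφt
  simp only [hpd, mul_neg, integral_neg, neg_inj] at h1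
  simp only [convolution, ContinuousLinearMap.flip_apply, ContinuousLinearMap.lsmul_apply,
    smul_eq_mul]
  simpa only [mul_comm, partialDeriv, hφ] using h1

lemma locallyIntegrable_norm {f : EuclideanSpace ℝ (Fin N) → ℝ} (hf : LocallyIntegrable f volume) :
    LocallyIntegrable (fun x => ‖f x‖) volume := fun x =>
  let ⟨s, hs, h⟩ := hf x
  ⟨s, hs, h.norm⟩

lemma tendsto_integral_mul_of_tendsto_setIntegral {K : Set (EuclideanSpace ℝ (Fin N))}
    (hK : IsCompact K) {h : ℕ → EuclideanSpace ℝ (Fin N) → ℝ} {h₀ : EuclideanSpace ℝ (Fin N) → ℝ}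
    (hh : ∀ n, LocallyIntegrable (h n) volume) (hh₀ : LocallyIntegrable h₀ volume)
    (hlim : Tendsto (fun n => ∫ x in K, ‖h n x - h₀ x‖) atTop (𝓝 0))
    {ψ : EuclideanSpace ℝ (Fin N) → ℝ} (hψ : Continuous ψ) (hψK : ∀ x ∉ K, ψ x = 0) :
    Tendsto (fun n => ∫ x, h n x * ψ x) atTop (𝓝 (∫ x, h₀ x * ψ x)) := by
  have hψc : HasCompactSupport ψ := HasCompactSupport.intro hK hψK
  obtain ⟨M, hM⟩ := hψc.exists_bound_of_continuous hψ
  have hi : ∀ {f : EuclideanSpace ℝ (Fin N) → ℝ}, LocallyIntegrable f volume →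
      Integrable (fun x => f x * ψ x) volume := fun hf => by
    simpa only [smul_eq_mul, mul_comm] using
      hf.integrable_smul_left_of_hasCompactSupport hψ hψc
  rw [tendsto_iff_norm_sub_tendsto_zero]
  have hlim' := hlim.const_mul M
  rw [mul_zero] at hlim'
  refine squeeze_zero (fun n => norm_nonneg _) (fun n => ?_) hlim'
  rw [← integral_sub (hi (hh n)) (hi hh₀), ← integral_const_mul]
  have e : ∫ x, (h n x * ψ x - h₀ x * ψ x) = ∫ x in K, (h n x - h₀ x) * ψ x := by
    rw [setIntegral_eq_integral_of_forall_compl_eq_zero fun x hx => by rw [hψK x hx, mul_zero]]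
    exact integral_congr_ae (Eventually.of_forall fun x => (sub_mul _ _ _).symm)
  rw [e]
  refine norm_integral_le_of_norm_le
    ((((hh n).sub hh₀).integrableOn_isCompact hK).norm.const_mul M)
    (Eventually.of_forall fun x => ?_)
  rw [norm_mul, mul_comm]
  exact mul_le_mul_of_nonneg_right (hM x) (norm_nonneg _)

/-- The chain rule for weak derivatives. -/
lemma weakDeriv_comp {Ω : Set (EuclideanSpace ℝ (Fin N))} (hΩ : IsOpen Ω) {i : Fin N}
    {w p : EuclideanSpace ℝ (Fin N) → ℝ} (hw : LocallyIntegrable w volume)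
    (hp : LocallyIntegrable p volume)
    (hwp : ∀ φ, IsTestFunction Ω φ → ∫ x, w x * partialDeriv i φ x = - ∫ x, p x * φ x)
    {γ : ℝ → ℝ} (hγ : ContDiff ℝ 1 γ) {C : ℝ} (hC : ∀ r, |deriv γ r| ≤ C)
    {φ : EuclideanSpace ℝ (Fin N) → ℝ} (hφ : IsTestFunction Ω φ) :
    ∫ x, γ (w x) * partialDeriv i φ x = - ∫ x, deriv γ (w x) * p x * φ x := by
  have hC0 : 0 ≤ C := (abs_nonneg _).trans (hC 0)
  have hγd : Differentiable ℝ γ := hγ.differentiable (by simp)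
  have hγ'c : Continuous (deriv γ) := hγ.continuous_deriv le_rfl
  have hlip : ∀ a b, ‖γ a - γ b‖ ≤ C * ‖a - b‖ := fun a b =>
    convex_univ.norm_image_sub_le_of_norm_deriv_le (fun x _ => hγd x) (fun x _ => hC x)
      (mem_univ b) (mem_univ a)
  set K := tsupport φ with hKdef
  have hK : IsCompact K := hφ.hasCompactSupport
  have hφK : ∀ x ∉ K, φ x = 0 := fun x hx => image_eq_zero_of_notMem_tsupport hx
  have hdφc : Continuous (partialDeriv i φ) :=
    (hφ.contDiff.continuous_fderiv (by simp)).clm_apply continuous_const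
  have hdφK : ∀ x ∉ K, partialDeriv i φ x = 0 := fun x hx => by
    have h : fderiv ℝ φ x = 0 := by
      by_contra hne
      exact hx (support_fderiv_subset ℝ hne)
    rw [partialDeriv, h, zero_apply]
  have hmw : ∀ n, ContDiff ℝ ∞ (mollify n w) := contDiff_mollify hw
  have hγw : LocallyIntegrable (fun x => γ (w x)) volume := by
    have hb : LocallyIntegrable (fun x => ‖γ 0‖ + C * ‖w x‖) volume :=
      (locallyIntegrable_const _).add ((locallyIntegrable_norm hw).smul C)
    refine hb.mono (hγ.continuous.comp_aestronglyMeasurable hw.aestronglyMeasurable)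
      (Eventually.of_forall fun x => ?_)
    have h1 := hlip (w x) 0
    have h2 := norm_sub_norm_le (γ (w x)) (γ 0)
    rw [sub_zero] at h1
    exact (by linarith : ‖γ (w x)‖ ≤ ‖γ 0‖ + C * ‖w x‖).trans (le_abs_self _)
  have hγ'p : LocallyIntegrable (fun x => deriv γ (w x) * p x) volume := by
    refine ((locallyIntegrable_norm hp).smul C).mono
      ((hγ'c.comp_aestronglyMeasurable hw.aestronglyMeasurable).mul hp.aestronglyMeasurable)
      (Eventually.of_forall fun x => ?_)
    rw [norm_mul]
    exact (mul_le_mul_of_nonneg_right (hC _) (norm_nonneg _)).trans (le_abs_self _)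
  have hγwn : ∀ n, Continuous fun x => γ (mollify n w x) := fun n =>
    hγ.continuous.comp (hmw n).continuous
  have hγ'pn : ∀ n, Continuous fun x => deriv γ (mollify n w x) * mollify n p x := fun n =>
    (hγ'c.comp (hmw n).continuous).mul (contDiff_mollify hp n).continuous
  have hlim1 : Tendsto (fun n => ∫ x, γ (mollify n w x) * partialDeriv i φ x) atTop
      (𝓝 (∫ x, γ (w x) * partialDeriv i φ x)) := by
    refine tendsto_integral_mul_of_tendsto_setIntegral hK (fun n => (hγwn n).locallyIntegrable)
      hγw ?_ hdφc hdφK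
    have h := (tendsto_setIntegral_norm_mollify_sub hw hK).const_mul C
    rw [mul_zero] at h
    refine squeeze_zero (fun n => integral_nonneg fun x => norm_nonneg _) (fun n => ?_) h
    rw [← integral_const_mul]
    refine integral_mono ?_ ?_ fun x => hlip _ _
    · exact ((((hγwn n).locallyIntegrable).sub hγw).integrableOn_isCompact hK).norm
    · exact (((((hmw n).continuous.locallyIntegrable).sub hw).integrableOn_isCompact
        hK).norm).const_mul C
  have hlim2 : Tendsto (fun n => ∫ x, deriv γ (mollify n w x) * mollify n p x * φ x) atTop
      (𝓝 (∫ x, deriv γ (w x) * p x * φ x)) := by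
    refine tendsto_integral_mul_of_tendsto_setIntegral hK (fun n => (hγ'pn n).locallyIntegrable)
      hγ'p ?_ hφ.contDiff.continuous hφK
    have hA := (tendsto_setIntegral_norm_mollify_sub hp hK).const_mul C
    have hpK := hp.integrableOn_isCompact hK
    have hmeas : ∀ n, AEStronglyMeasurable
        (fun x => (deriv γ (mollify n w x) - deriv γ (w x)) * p x) (volume.restrict K) := fun n =>
      (((hγ'c.comp (hmw n).continuous).aestronglyMeasurable.sub
        (hγ'c.comp_aestronglyMeasurable hw.aestronglyMeasurable)).mul
        hp.aestronglyMeasurable).restrict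
    have hdom : ∀ n x, ‖(deriv γ (mollify n w x) - deriv γ (w x)) * p x‖ ≤ 2 * C * ‖p x‖ := by
      intro n x
      rw [norm_mul]
      refine mul_le_mul_of_nonneg_right ?_ (norm_nonneg _)
      exact (abs_sub _ _).trans (by linarith [hC (mollify n w x), hC (w x)])
    have hB : Tendsto (fun n => ∫ x in K, ‖(deriv γ (mollify n w x) - deriv γ (w x)) * p x‖) atTop
        (𝓝 (∫ _ in K, (0 : ℝ))) := by
      refine tendsto_integral_of_dominated_convergence (fun x => 2 * C * ‖p x‖)
        (fun n => (hmeas n).norm) (hpK.norm.const_mul _)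
        (fun n => Eventually.of_forall fun x => ?_) ?_
      · rw [norm_norm]
        exact hdom n x
      · filter_upwards [ae_restrict_of_ae (ae_tendsto_mollify hw)] with x hx
        have h := ((hγ'c.tendsto _).comp hx).sub_const (deriv γ (w x)) |>.mul_const (p x) |>.norm
        rwa [sub_self, zero_mul, norm_zero] at h
    have hAB := hA.add hB
    rw [mul_zero, integral_zero, add_zero] at hAB
    refine squeeze_zero (fun n => integral_nonneg fun x => norm_nonneg _) (fun n => ?_) hAB
    have hi1 : IntegrableOn (fun x => C * ‖mollify n p x - p x‖) K volume :=
      ((((contDiff_mollify hp n).continuous.locallyIntegrable.sub hp).integrableOn_isCompact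
        hK).norm).const_mul C
    have hi2 : IntegrableOn
        (fun x => ‖(deriv γ (mollify n w x) - deriv γ (w x)) * p x‖) K volume :=
      (hpK.norm.const_mul (2 * C)).mono' (hmeas n).norm
        (Eventually.of_forall fun x => by rw [norm_norm]; exact hdom n x)
    rw [← integral_const_mul, ← integral_add hi1 hi2]
    refine integral_mono ?_ (hi1.add hi2) fun x => ?_
    · exact ((((hγ'pn n).locallyIntegrable).sub hγ'p).integrableOn_isCompact hK).norm
    · have e : deriv γ (mollify n w x) * mollify n p x - deriv γ (w x) * p x =
          deriv γ (mollify n w x) * (mollify n p x - p x) +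
            (deriv γ (mollify n w x) - deriv γ (w x)) * p x := by ring
      simp only [e]
      refine (norm_add_le _ _).trans (add_le_add ?_ le_rfl)
      rw [norm_mul]
      exact mul_le_mul_of_nonneg_right (hC _) (norm_nonneg _)
  obtain ⟨δ, hδ, hδΩ⟩ := hK.exists_cthickening_subset_open hΩ hφ.tsupport_subset
  have heq : ∀ᶠ n in atTop, ∫ x, γ (mollify n w x) * partialDeriv i φ x =
      - ∫ x, deriv γ (mollify n w x) * mollify n p x * φ x := by
    filter_upwards [tendsto_mollifierBump_rOut.eventually (ge_mem_nhds hδ)] with n hn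
    have hcomp : ∀ x, HasFDerivAt (fun x => γ (mollify n w x))
        (deriv γ (mollify n w x) • fderiv ℝ (mollify n w) x) x := fun x =>
      (hγd _).hasDerivAt.comp_hasFDerivAt x (((hmw n).differentiable (by simp)) x).hasFDerivAt
    have hfd : ∀ x, fderiv ℝ (fun x => γ (mollify n w x)) x (EuclideanSpace.single i 1) =
        deriv γ (mollify n w x) * partialDeriv i (mollify n w) x := fun x => by
      rw [(hcomp x).fderiv]
      rfl
    have hcd : Continuous (partialDeriv i (mollify n w)) :=
      ((hmw n).continuous_fderiv (by simp)).clm_apply continuous_const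
    have hcs : ∀ {f : EuclideanSpace ℝ (Fin N) → ℝ} {ψ : EuclideanSpace ℝ (Fin N) → ℝ},
        Continuous f → Continuous ψ → (∀ x ∉ K, ψ x = 0) →
        Integrable (fun x => f x * ψ x) volume := fun hf hψ hψK =>
      (hf.mul hψ).integrable_of_hasCompactSupport
        (HasCompactSupport.intro hK fun x hx => by
          rw [Pi.mul_apply, hψK x hx, mul_zero])
    have h := integral_mul_fderiv_eq_neg_fderiv_mul_of_integrable (μ := volume)
      (f := fun x => γ (mollify n w x)) (g := φ) (v := EuclideanSpace.single i 1)
      (by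
        simp only [hfd]
        exact hcs ((hγ'c.comp (hmw n).continuous).mul hcd) hφ.contDiff.continuous hφK)
      (hcs (hγwn n) hdφc hdφK) (hcs (hγwn n) hφ.contDiff.continuous hφK)
      (fun x _ => (hcomp x).differentiableAt)
      (fun x _ => (hφ.contDiff.differentiable (by simp)) x)
    refine h.trans ?_
    congr 1
    refine integral_congr_ae (Eventually.of_forall fun x => ?_)
    simp only [hfd]
    by_cases hx : x ∈ K
    · rw [partialDeriv_mollify hw hwp]
      exact (Metric.closedBall_subset_closedBall hn).trans
        ((Metric.closedBall_subset_cthickening hx δ).trans hδΩ)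
    · rw [hφK x hx, mul_zero, mul_zero]
  exact tendsto_nhds_unique_of_eventuallyEq hlim1 hlim2.neg heq

end Mollify

/-! ### The spaces `H¹(Ω)` and `W` -/

section Sobolev

variable {N : ℕ} {Ω : Set (EuclideanSpace ℝ (Fin N))}

lemma L2_inner_eq (w z : L2 Ω) : ⟪w, z⟫_ℝ = ∫ x in Ω, w x * z x := by
  rw [L2.inner_def]
  refine integral_congr_ae (Eventually.of_forall fun x => ?_)
  simp [mul_comm]

lemma integral_mul_eq_inner (w : L2 Ω) {ψ : EuclideanSpace ℝ (Fin N) → ℝ}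
    (hψ : MemLp ψ 2 (volume.restrict Ω)) : ∫ x in Ω, w x * ψ x = ⟪w, hψ.toLp ψ⟫_ℝ := by
  rw [L2_inner_eq]
  refine integral_congr_ae ?_
  filter_upwards [hψ.coeFn_toLp] with x hx
  rw [hx]

lemma isClosed_H1Graph : IsClosed (H1Graph Ω : Set (WithLp 2 (L2 Ω × PiLp 2 fun _ : Fin N => L2 Ω))) := by
  have e : (H1Graph Ω : Set (WithLp 2 (L2 Ω × PiLp 2 fun _ : Fin N => L2 Ω))) =
      ⋂ (i : Fin N) (φ : EuclideanSpace ℝ (Fin N) → ℝ) (hφ : IsTestFunction Ω φ),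
        {z | ⟪z.fst, (hφ.memLp_partialDeriv i).toLp _⟫_ℝ = - ⟪z.snd i, hφ.memLp.toLp _⟫_ℝ} := by
    ext z
    simp only [mem_iInter, mem_ofPred_eq, ← integral_mul_eq_inner]
    rfl
  rw [e]
  have h1 : Continuous fun z : WithLp 2 (L2 Ω × PiLp 2 fun _ : Fin N => L2 Ω) => z.fst :=
    (WithLp.fstL 2 ℝ (L2 Ω) (PiLp 2 (fun _ : Fin N => L2 Ω))).continuous
  have h2 : ∀ i, Continuous fun z : WithLp 2 (L2 Ω × PiLp 2 fun _ : Fin N => L2 Ω) => z.snd i :=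
    fun i => ((PiLp.proj 2 (fun _ : Fin N => L2 Ω) i).comp
      (WithLp.sndL 2 ℝ (L2 Ω) (PiLp 2 (fun _ : Fin N => L2 Ω)))).continuous
  exact isClosed_iInter fun i => isClosed_iInter fun φ => isClosed_iInter fun hφ =>
    isClosed_eq (h1.inner continuous_const) ((h2 i).inner continuous_const).neg

instance : CompleteSpace (H1 Ω) :=
  (isClosed_H1Graph (Ω := Ω)).completeSpace_coe

/-- The Riesz representative of `h ∈ H ⊆ V*` in `V`. -/
lemma toDual_symm_toVStar (h : L2 Ω) :
    (InnerProductSpace.toDual ℝ (H1 Ω)).symm (toVStar h) =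
      ContinuousLinearMap.adjoint H1.toL2 h := by
  refine ext_inner_right ℝ fun v => ?_
  rw [InnerProductSpace.toDual_symm_apply, ContinuousLinearMap.adjoint_inner_left]
  rfl

lemma norm_toVStar_sub (h h' : L2 Ω) :
    ‖toVStar h - toVStar h'‖ = ‖ContinuousLinearMap.adjoint H1.toL2 (h - h')‖ := by
  rw [map_sub, ← toDual_symm_toVStar, ← toDual_symm_toVStar, ← map_sub,
    LinearIsometryEquiv.norm_map]

lemma IsTestFunction.exists_H1 {φ : EuclideanSpace ℝ (Fin N) → ℝ}
    (hφ : IsTestFunction Ω φ) : ∃ v : H1 Ω, ∀ᵐ x ∂volume.restrict Ω, H1.toL2 v x = φ x := by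
  let z : WithLp 2 (L2 Ω × PiLp 2 fun _ : Fin N => L2 Ω) :=
    WithLp.toLp 2 (hφ.memLp.toLp _, WithLp.toLp 2 fun i => (hφ.memLp_partialDeriv i).toLp _)
  have hz : z ∈ H1Graph Ω := by
    intro i ψ hψ
    change ∫ x in Ω, hφ.memLp.toLp _ x * partialDeriv i ψ x =
      - ∫ x in Ω, (hφ.memLp_partialDeriv i).toLp _ x * ψ x
    have e1 : ∫ x in Ω, hφ.memLp.toLp _ x * partialDeriv i ψ x =
        ∫ x in Ω, φ x * partialDeriv i ψ x := integral_congr_ae (by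
      filter_upwards [hφ.memLp.coeFn_toLp] with x hx
      rw [hx])
    have e2 : ∫ x in Ω, (hφ.memLp_partialDeriv i).toLp _ x * ψ x =
        ∫ x in Ω, partialDeriv i φ x * ψ x := integral_congr_ae (by
      filter_upwards [(hφ.memLp_partialDeriv i).coeFn_toLp] with x hx
      rw [hx])
    have hφ0 : ∀ x ∉ Ω, φ x = 0 := fun x hx =>
      image_eq_zero_of_notMem_tsupport fun h => hx (hφ.tsupport_subset h)
    have hψ0 : ∀ x ∉ Ω, ψ x = 0 := fun x hx =>
      image_eq_zero_of_notMem_tsupport fun h => hx (hψ.tsupport_subset h)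
    rw [e1, e2,
      setIntegral_eq_integral_of_forall_compl_eq_zero (fun x hx => by rw [hφ0 x hx, zero_mul]),
      setIntegral_eq_integral_of_forall_compl_eq_zero (fun x hx => by rw [hψ0 x hx, mul_zero])]
    have hdc : ∀ {φ : EuclideanSpace ℝ (Fin N) → ℝ}, IsTestFunction Ω φ →
        Continuous (partialDeriv i φ) := fun h =>
      (h.contDiff.continuous_fderiv (by simp)).clm_apply continuous_const
    refine integral_mul_fderiv_eq_neg_fderiv_mul_of_integrable ?_ ?_ ?_
      (fun x _ => (hφ.contDiff.differentiable (by simp)) x)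
      (fun x _ => (hψ.contDiff.differentiable (by simp)) x)
    · exact ((hdc hφ).mul hψ.contDiff.continuous).integrable_of_hasCompactSupport
        hψ.hasCompactSupport.mul_left
    · exact (hφ.contDiff.continuous.mul (hdc hψ)).integrable_of_hasCompactSupport
        hφ.hasCompactSupport.mul_right
    · exact (hφ.contDiff.continuous.mul hψ.contDiff.continuous).integrable_of_hasCompactSupport
        hφ.hasCompactSupport.mul_right
  exact ⟨⟨z, hz⟩, hφ.memLp.coeFn_toLp⟩

/-- Test functions are dense in `H`, so that `H` embeds in `V*`. -/
lemma adjoint_toL2_injective (hΩ : IsOpen Ω) {h : L2 Ω}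
    (h0 : ContinuousLinearMap.adjoint H1.toL2 h = 0) : h = 0 := by
  have hloc : LocallyIntegrableOn h Ω volume := by
    rw [locallyIntegrableOn_iff hΩ.isLocallyClosed]
    intro K hKΩ hK
    have : IsFiniteMeasure (volume.restrict K) := ⟨by simpa using hK.measure_lt_top⟩
    exact (((Lp.memLp h).mono_measure (Measure.restrict_mono hKΩ le_rfl)).integrable
      (by norm_num))
  rw [Lp.eq_zero_iff_ae_eq_zero, EventuallyEq, ae_restrict_iff' hΩ.measurableSet]
  refine hΩ.ae_eq_zero_of_integral_contDiff_smul_eq_zero hloc fun φ hφ1 hφ2 hφ3 => ?_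
  obtain ⟨v, hv⟩ := IsTestFunction.exists_H1 (Ω := Ω) ⟨hφ1, hφ2, hφ3⟩
  have h1 : ⟪h, H1.toL2 v⟫_ℝ = 0 := by
    rw [← ContinuousLinearMap.adjoint_inner_left, h0, inner_zero_left]
  rw [L2_inner_eq] at h1
  rw [← h1, ← setIntegral_eq_integral_of_forall_compl_eq_zero (s := Ω) fun x hx => by
    rw [image_eq_zero_of_notMem_tsupport fun h => hx (hφ3 h), zero_smul]]
  refine integral_congr_ae ?_
  filter_upwards [hv] with x hx
  rw [hx, smul_eq_mul, mul_comm]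

/-- Green's formula on `W`: `-Δ + 1` represents the inner product of `V`. -/
lemma W.inner_toH1 (w : W Ω) (v : H1 Ω) :
    ⟪H2.toH1 w.1, v⟫_ℝ = ⟪W.negLaplacianAddOne w, H1.toL2 v⟫_ℝ := by
  have h : (∑ i, ⟪H1.deriv i (H2.toH1 w.1), H1.deriv i v⟫_ℝ) +
      ⟪H2.laplacian w.1, H1.toL2 v⟫_ℝ = 0 := w.2 v
  rw [H1.inner_eq, W.negLaplacianAddOne, inner_sub_left, eq_neg_of_add_eq_zero_left h]
  rfl

lemma W.adjoint_negLaplacianAddOne (w : W Ω) :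
    ContinuousLinearMap.adjoint H1.toL2 (W.negLaplacianAddOne w) = H2.toH1 w.1 := by
  refine ext_inner_right ℝ fun v => ?_
  rw [ContinuousLinearMap.adjoint_inner_left, W.inner_toH1]

/-- `-Δ + 1` is symmetric on `W`. -/
lemma W.inner_negLaplacianAddOne_comm (w z : W Ω) :
    ⟪W.negLaplacianAddOne w, W.toL2 z⟫_ℝ = ⟪W.toL2 w, W.negLaplacianAddOne z⟫_ℝ := by
  have h1 := W.inner_toH1 w (H2.toH1 z.1)
  have h2 := W.inner_toH1 z (H2.toH1 w.1)
  rw [real_inner_comm] at h2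
  rw [real_inner_comm _ (W.toL2 w)]
  exact h1.symm.trans h2

/-- `-Δ + 1 : W → H` as a bounded linear map. -/
def negLaplacianAddOneL (Ω : Set (EuclideanSpace ℝ (Fin N))) : W Ω →L[ℝ] L2 Ω :=
  (H2.toL2 - H2.laplacian).comp (W Ω).subtypeL

lemma integral_indicator_mul (hΩ : IsOpen Ω) (w ψ : EuclideanSpace ℝ (Fin N) → ℝ) :
    ∫ x, Ω.indicator w x * ψ x = ∫ x in Ω, w x * ψ x := by
  rw [← integral_indicator hΩ.measurableSet]
  exact integral_congr_ae (Eventually.of_forall fun x => (indicator_mul_left _ _ _).symm)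

lemma locallyIntegrable_indicator (hΩ : IsOpen Ω) (w : L2 Ω) :
    LocallyIntegrable (Ω.indicator w) volume :=
  ((memLp_indicator_iff_restrict hΩ.measurableSet).2 (Lp.memLp w)).locallyIntegrable (by norm_num)

/-- `H¹(Ω)` is stable under composition with `C¹` functions of bounded derivative. -/
lemma exists_H1_comp (hΩ : IsOpen Ω) (w : H1 Ω) {γ : ℝ → ℝ} (hγ : ContDiff ℝ 1 γ)
    (hγ0 : γ 0 = 0) {C : ℝ} (hC : ∀ r, |deriv γ r| ≤ C) :
    ∃ G : H1 Ω, (∀ᵐ x ∂volume.restrict Ω, H1.toL2 G x = γ (H1.toL2 w x)) ∧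
      ∀ i, ∀ᵐ x ∂volume.restrict Ω,
        H1.deriv i G x = deriv γ (H1.toL2 w x) * H1.deriv i w x := by
  have hγd : Differentiable ℝ γ := hγ.differentiable (by simp)
  have h1 : MemLp (fun x => γ (H1.toL2 w x)) 2 (volume.restrict Ω) := by
    refine (Lp.memLp (H1.toL2 w)).of_le_mul (c := C)
      (hγ.continuous.comp_aestronglyMeasurable (Lp.memLp _).1) (Eventually.of_forall fun x => ?_)
    have h := convex_univ.norm_image_sub_le_of_norm_deriv_le (fun x _ => hγd x)
      (fun x _ => hC x) (mem_univ 0) (mem_univ (H1.toL2 w x))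
    rwa [hγ0, sub_zero, sub_zero] at h
  have h2 : ∀ i, MemLp (fun x => deriv γ (H1.toL2 w x) * H1.deriv i w x) 2
      (volume.restrict Ω) := fun i => by
    refine (Lp.memLp (H1.deriv i w)).of_le_mul (c := C)
      (((hγ.continuous_deriv le_rfl).comp_aestronglyMeasurable (Lp.memLp _).1).mul (Lp.memLp _).1)
      (Eventually.of_forall fun x => ?_)
    rw [norm_mul]
    exact mul_le_mul_of_nonneg_right (hC _) (norm_nonneg _)
  let z : WithLp 2 (L2 Ω × PiLp 2 fun _ : Fin N => L2 Ω) :=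
    WithLp.toLp 2 (h1.toLp _, WithLp.toLp 2 fun i => (h2 i).toLp _)
  have hz : z ∈ H1Graph Ω := by
    intro i φ hφ
    change ∫ x in Ω, h1.toLp _ x * partialDeriv i φ x = - ∫ x in Ω, (h2 i).toLp _ x * φ x
    have hwp : ∀ φ, IsTestFunction Ω φ →
        ∫ x, Ω.indicator (H1.toL2 w) x * partialDeriv i φ x =
          - ∫ x, Ω.indicator (H1.deriv i w) x * φ x := fun φ hφ => by
      rw [integral_indicator_mul hΩ, integral_indicator_mul hΩ]
      exact H1.hasWeakDeriv w i φ hφ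
    have h := weakDeriv_comp hΩ (locallyIntegrable_indicator hΩ _)
      (locallyIntegrable_indicator hΩ _) hwp hγ hC hφ
    have e1 : ∀ x, γ (Ω.indicator (H1.toL2 w) x) =
        Ω.indicator (fun x => γ (H1.toL2 w x)) x := fun x => by
      by_cases hx : x ∈ Ω <;> simp [hx, hγ0]
    have e2 : ∀ x, deriv γ (Ω.indicator (H1.toL2 w) x) * Ω.indicator (H1.deriv i w) x =
        Ω.indicator (fun x => deriv γ (H1.toL2 w x) * H1.deriv i w x) x := fun x => by
      by_cases hx : x ∈ Ω <;> simp [hx]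
    simp only [e1, e2] at h
    rw [integral_indicator_mul hΩ, integral_indicator_mul hΩ] at h
    have e3 : ∫ x in Ω, h1.toLp _ x * partialDeriv i φ x =
        ∫ x in Ω, γ (H1.toL2 w x) * partialDeriv i φ x := integral_congr_ae (by
      filter_upwards [h1.coeFn_toLp] with x hx
      rw [hx])
    have e4 : ∫ x in Ω, (h2 i).toLp _ x * φ x =
        ∫ x in Ω, deriv γ (H1.toL2 w x) * H1.deriv i w x * φ x := integral_congr_ae (by
      filter_upwards [(h2 i).coeFn_toLp] with x hx
      rw [hx])
    rw [e3, e4, h]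
  exact ⟨⟨z, hz⟩, h1.coeFn_toLp, fun i => (h2 i).coeFn_toLp⟩

/-! ### Accretivity of the Neumann Laplacian with respect to monotone functions -/

lemma integral_comp_mul_nonneg_of_contDiff (hΩ : IsOpen Ω) (w : W Ω) {γ : ℝ → ℝ}
    (hγ : ContDiff ℝ 1 γ) (hγ0 : γ 0 = 0) {C : ℝ} (hC : ∀ r, |deriv γ r| ≤ C)
    (hmono : Monotone γ) : 0 ≤ ∫ x in Ω, γ (W.toL2 w x) * W.negLaplacianAddOne w x := by
  obtain ⟨G, hG, hG'⟩ := exists_H1_comp hΩ (H2.toH1 w.1) hγ hγ0 hC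
  have h := W.inner_toH1 w G
  have e : ⟪W.negLaplacianAddOne w, H1.toL2 G⟫_ℝ =
      ∫ x in Ω, γ (W.toL2 w x) * W.negLaplacianAddOne w x := by
    rw [L2_inner_eq]
    refine integral_congr_ae ?_
    filter_upwards [hG] with x hx
    rw [hx, mul_comm]
    rfl
  rw [← e, ← h, H1.inner_eq, L2_inner_eq]
  refine add_nonneg (integral_nonneg_of_ae ?_) (Finset.sum_nonneg fun i _ => ?_)
  · filter_upwards [hG] with x hx
    rw [hx, Pi.zero_apply]
    rcases le_total 0 (H1.toL2 (H2.toH1 w.1) x) with hs | hs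
    · exact mul_nonneg hs (hγ0 ▸ hmono hs)
    · exact mul_nonneg_of_nonpos_of_nonpos hs (hγ0 ▸ hmono hs)
  · rw [L2_inner_eq]
    refine integral_nonneg_of_ae ?_
    filter_upwards [hG' i] with x hx
    rw [hx, Pi.zero_apply, mul_left_comm]
    exact mul_nonneg hmono.deriv_nonneg (mul_self_nonneg _)

lemma integral_comp_mul_nonneg_of_tendsto {ι : Type*} {l : Filter ι} [l.IsCountablyGenerated]
    [l.NeBot] {γ : ι → ℝ → ℝ} {b : ℝ → ℝ} {w a : L2 Ω} {h : EuclideanSpace ℝ (Fin N) → ℝ}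
    (hγ : ∀ k, Continuous (γ k)) (hlim : ∀ r, Tendsto (fun k => γ k r) l (𝓝 (b r)))
    (hh : MemLp h 2 (volume.restrict Ω)) (hle : ∀ᶠ k in l, ∀ x, |γ k (w x)| ≤ |h x|)
    (hnn : ∀ᶠ k in l, 0 ≤ ∫ x in Ω, γ k (w x) * a x) : 0 ≤ ∫ x in Ω, b (w x) * a x := by
  have ht : Tendsto (fun k => ∫ x in Ω, γ k (w x) * a x) l (𝓝 (∫ x in Ω, b (w x) * a x)) := by
    refine tendsto_integral_filter_of_dominated_convergence (fun x => |h x| * |a x|)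
      (Eventually.of_forall fun k =>
        ((hγ k).comp_aestronglyMeasurable (Lp.memLp w).1).mul (Lp.memLp a).1)
      (hle.mono fun k hk => Eventually.of_forall fun x => ?_)
      (hh.norm.integrable_mul (Lp.memLp a).norm)
      (Eventually.of_forall fun x => (hlim _).mul_const _)
    rw [norm_mul]
    exact mul_le_mul_of_nonneg_right (hk x) (norm_nonneg _)
  exact ge_of_tendsto ht hnn

lemma integral_comp_mul_nonneg_of_lipschitz (hΩ : IsOpen Ω) (w : W Ω) {b : ℝ → ℝ} {C : ℝ}
    (hb : ∀ r s, |b r - b s| ≤ C * |r - s|) (hb0 : b 0 = 0) (hmono : Monotone b) :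
    0 ≤ ∫ x in Ω, b (W.toL2 w x) * W.negLaplacianAddOne w x := by
  have hbc : Continuous b := by
    refine (LipschitzWith.of_dist_le_mul (K := C.toNNReal) fun r s => ?_).continuous
    rw [Real.dist_eq, Real.dist_eq]
    exact (hb r s).trans (mul_le_mul_of_nonneg_right (Real.le_coe_toNNReal C) (abs_nonneg _))
  set F : ℝ → ℝ := fun r => ∫ s in (0 : ℝ)..r, b s with hF
  have hFd : ∀ r, HasDerivAt F (b r) r := fun r =>
    intervalIntegral.integral_hasDerivAt_right (hbc.intervalIntegrable _ _)
      hbc.stronglyMeasurable.stronglyMeasurableAtFilter hbc.continuousAt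
  -- averages of `b` over `[r, r + δ]`, normalised to vanish at `0`
  set γ : ℝ → ℝ → ℝ := fun δ r => δ⁻¹ • (F (r + δ) - F r) - δ⁻¹ • (F (0 + δ) - F 0) with hγ
  have hγd : ∀ δ r, HasDerivAt (γ δ) (δ⁻¹ * (b (r + δ) - b r)) r := fun δ r =>
    ((((hFd (r + δ)).comp_add_const r δ).sub (hFd r)).const_mul δ⁻¹).sub_const _
  have hγ' : ∀ δ, deriv (γ δ) = fun r => δ⁻¹ * (b (r + δ) - b r) := fun δ =>
    funext fun r => (hγd δ r).deriv
  have hγ1 : ∀ δ, ContDiff ℝ 1 (γ δ) := fun δ => by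
    rw [contDiff_one_iff_deriv, hγ']
    exact ⟨fun r => (hγd δ r).differentiableAt, by fun_prop⟩
  have hγ0 : ∀ δ, γ δ 0 = 0 := fun δ => sub_self _
  have hbd : ∀ δ > 0, ∀ r, |deriv (γ δ) r| ≤ C := fun δ hδ r => by
    rw [hγ', abs_mul, abs_of_pos (inv_pos.2 hδ), inv_mul_le_iff₀ hδ]
    have h := hb (r + δ) r
    rwa [add_sub_cancel_left, abs_of_pos hδ, mul_comm] at h
  refine integral_comp_mul_nonneg_of_tendsto (l := 𝓝[>] (0 : ℝ)) (γ := γ)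
    (h := fun x => C * W.toL2 w x)
    (fun δ => (hγ1 δ).continuous) (fun r => ?_) ((Lp.memLp (W.toL2 w)).const_mul C) ?_ ?_
  · have h := (hFd r).tendsto_slope_zero_right.sub (hFd 0).tendsto_slope_zero_right
    rwa [hb0, sub_zero] at h
  · filter_upwards [self_mem_nhdsWithin] with δ hδ x
    have h := convex_univ.norm_image_sub_le_of_norm_deriv_le
      (fun r _ => (hγd δ r).differentiableAt) (fun r _ => hbd δ hδ r) (mem_univ 0)
      (mem_univ (W.toL2 w x))
    rw [hγ0, sub_zero, sub_zero] at h
    refine h.trans ?_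
    rw [abs_mul]
    exact mul_le_mul_of_nonneg_right (le_abs_self C) (abs_nonneg _)
  · filter_upwards [self_mem_nhdsWithin] with δ hδ
    refine integral_comp_mul_nonneg_of_contDiff hΩ w (hγ1 δ) (hγ0 δ) (hbd δ hδ)
      (monotone_of_deriv_nonneg (fun r => (hγd δ r).differentiableAt) fun r => ?_)
    rw [hγ']
    exact mul_nonneg (inv_pos.2 hδ).le (sub_nonneg.2 (hmono (by linarith [mem_Ioi.1 hδ])))

/-- The Yosida approximation of a continuous monotone function that vanishes at `0`. -/
lemma exists_yosida {b : ℝ → ℝ} (hb : Continuous b) (hmono : Monotone b) (hb0 : b 0 = 0) {c : ℝ}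
    (hc : 0 < c) : ∃ y : ℝ → ℝ, Monotone y ∧ y 0 = 0 ∧ (∀ r s, |y r - y s| ≤ c * |r - s|) ∧
      (∀ r, |y r| ≤ |b r|) ∧ ∀ r, ∃ s, |r - s| ≤ |b r| / c ∧ y r = b s := by
  set ψ : ℝ → ℝ := fun s => s + b s / c with hψ
  have hψm : StrictMono ψ := fun s t hst =>
    add_lt_add_of_lt_of_le hst (div_le_div_of_nonneg_right (hmono hst.le) hc.le)
  have hψs : Function.Surjective ψ := by
    have hψc : Continuous ψ := by fun_prop
    refine hψc.surjective ?_ ?_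
    · refine tendsto_atTop_mono' _ ?_ tendsto_id
      filter_upwards [eventually_ge_atTop 0] with s hs
      exact le_add_of_nonneg_right (div_nonneg (hb0 ▸ hmono hs) hc.le)
    · refine tendsto_atBot_mono' _ ?_ tendsto_id
      filter_upwards [eventually_le_atBot 0] with s hs
      exact add_le_of_nonpos_right (div_nonpos_of_nonpos_of_nonneg (hb0 ▸ hmono hs) hc.le)
  set J := (hψm.orderIsoOfSurjective ψ hψs).symm with hJ
  have hψJ : ∀ r, J r + b (J r) / c = r := fun r =>
    (hψm.orderIsoOfSurjective ψ hψs).apply_symm_apply r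
  have hbJ : ∀ r, b (J r) = c * (r - J r) := fun r => by
    have h := hψJ r
    field_simp at h
    linarith
  have hJ0 : J 0 = 0 := by
    refine (hψm.injective ?_ : J 0 = 0)
    have h := hψJ 0
    simpa [hψ, hb0] using h
  have hle : ∀ r, |b (J r)| ≤ |b r| := fun r => by
    rcases le_total 0 r with hr | hr
    · have h0 : 0 ≤ J r := hJ0 ▸ J.monotone hr
      have h1 : 0 ≤ b (J r) := hb0 ▸ hmono h0
      have h2 : b (J r) ≤ b r := hmono (by nlinarith [hbJ r])
      rw [abs_of_nonneg h1, abs_of_nonneg (h1.trans h2)]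
      exact h2
    · have h0 : J r ≤ 0 := hJ0 ▸ J.monotone hr
      have h1 : b (J r) ≤ 0 := hb0 ▸ hmono h0
      have h2 : b r ≤ b (J r) := hmono (by nlinarith [hbJ r])
      rw [abs_of_nonpos h1, abs_of_nonpos (h2.trans h1)]
      linarith
  have hord : ∀ r s, r ≤ s → |b (J r) - b (J s)| ≤ c * |r - s| := fun r s hrs => by
    have h1 := J.monotone hrs
    have h2 := hmono h1
    rw [abs_of_nonpos (by linarith), abs_of_nonpos (by linarith), hbJ, hbJ]
    nlinarith
  refine ⟨fun r => b (J r), hmono.comp J.monotone, by simp only [hJ0, hb0], fun r s => ?_, hle,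
    fun r => ⟨J r, ?_, rfl⟩⟩
  · rcases le_total r s with h | h
    · exact hord r s h
    · rw [abs_sub_comm, abs_sub_comm r]
      exact hord s r h
  · rw [le_div_iff₀ hc]
    refine le_trans (le_of_eq ?_) (hle r)
    rw [hbJ, abs_mul, abs_of_pos hc, mul_comm]

/-- `(β(w), (-Δ + 1) w)_H ≥ 0` for `w ∈ W` with `β(w) ∈ H`. -/
lemma integral_comp_mul_nonneg (hΩ : IsOpen Ω) (w : W Ω) {b : ℝ → ℝ} (hb : Continuous b)
    (hmono : Monotone b) (hb0 : b 0 = 0)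
    (hbw : MemLp (fun x => b (W.toL2 w x)) 2 (volume.restrict Ω)) :
    0 ≤ ∫ x in Ω, b (W.toL2 w x) * W.negLaplacianAddOne w x := by
  choose y hym hy0 hyl hyle hyJ using
    fun n : ℕ => exists_yosida hb hmono hb0 (c := n + 1) (by positivity)
  refine integral_comp_mul_nonneg_of_tendsto (l := atTop) (γ := y) (fun n => ?_) (fun r => ?_)
    hbw (Eventually.of_forall fun n x => hyle n _)
    (Eventually.of_forall fun n => integral_comp_mul_nonneg_of_lipschitz hΩ w (hyl n) (hy0 n)
      (hym n))
  · refine (LipschitzWith.of_dist_le_mul (K := n + 1) fun r s => ?_).continuous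
    exact hyl n r s
  · choose s hs hs' using fun n => hyJ n r
    simp only [hs']
    refine (hb.tendsto r).comp ?_
    rw [tendsto_iff_norm_sub_tendsto_zero]
    refine squeeze_zero (fun n => norm_nonneg _) (fun n => ?_)
      (tendsto_const_nhds.div_atTop
        (tendsto_natCast_atTop_atTop.atTop_add (tendsto_const_nhds (x := (1 : ℝ)))) :
        Tendsto (fun n : ℕ => |b r| / ((n : ℝ) + 1)) atTop (𝓝 0))
    rw [norm_sub_rev]
    exact hs n

end Sobolev

/-! ### The nonlinearities -/

section Nonlinearities

variable {N : ℕ} {Ω : Set (EuclideanSpace ℝ (Fin N))} {β βhat : ℝ → ℝ} {c₁ : ℝ}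

lemma CondBeta.monotone (hβ : CondBeta Ω β βhat c₁) : Monotone β := by
  refine monotone_iff_forall_lt.2 fun x y hxy => ?_
  exact (hβ.convexOn.le_slope_of_hasDerivAt (mem_univ x) (mem_univ y) hxy (hβ.hasDerivAt x)).trans
    (hβ.convexOn.slope_le_of_hasDerivAt (mem_univ x) (mem_univ y) hxy (hβ.hasDerivAt y))

lemma CondBeta.apply_zero (hβ : CondBeta Ω β βhat c₁) : β 0 = 0 := by
  refine IsLocalMin.hasDerivAt_eq_zero (f := βhat) (Eventually.of_forall fun r => ?_)
    (hβ.hasDerivAt 0)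
  rw [hβ.map_zero]
  exact (mul_nonneg hβ.c₁_pos.le (sq_nonneg _)).trans (hβ.lower_bound r)

/-- A derivative has the intermediate value property, and `β` is unbounded in both directions by the
quadratic growth of `βhat`; a monotone surjection is continuous. -/
lemma CondBeta.continuous (hβ : CondBeta Ω β βhat c₁) : Continuous β := by
  have hc := hβ.c₁_pos
  have hpos : ∀ r > 0, c₁ * r ≤ β r := fun r hr => by
    have h := hβ.convexOn.slope_le_of_hasDerivAt (mem_univ 0) (mem_univ r) hr (hβ.hasDerivAt r)
    rw [slope_def_field, hβ.map_zero, sub_zero, sub_zero, div_le_iff₀ hr] at h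
    have h2 := hβ.lower_bound r
    rw [sq_abs] at h2
    nlinarith
  have hneg : ∀ r < 0, β r ≤ c₁ * r := fun r hr => by
    have h := hβ.convexOn.le_slope_of_hasDerivAt (mem_univ r) (mem_univ 0) hr (hβ.hasDerivAt r)
    rw [slope_def_field, hβ.map_zero, zero_sub, zero_sub, le_div_iff₀ (neg_pos.2 hr)] at h
    have h2 := hβ.lower_bound r
    rw [sq_abs] at h2
    nlinarith
  refine hβ.monotone.continuous_of_surjective fun y => ?_
  have hord := ordConnected_univ.image_hasDerivWithinAt fun x _ =>
    (hβ.hasDerivAt x).hasDerivWithinAt (s := univ)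
  rw [image_univ] at hord
  have hM : 0 < |y| / c₁ + 1 := by positivity
  have e : c₁ * (|y| / c₁ + 1) = |y| + c₁ := by field_simp
  refine hord.out (mem_range_self (-(|y| / c₁ + 1))) (mem_range_self (|y| / c₁ + 1)) ⟨?_, ?_⟩
  · refine (hneg _ (neg_neg_of_pos hM)).trans ?_
    rw [mul_neg, e]
    linarith [neg_abs_le y]
  · refine le_trans ?_ (hpos _ hM)
    rw [e]
    linarith [le_abs_self y]

lemma abs_le_of_eLpNorm_deriv_le {π : ℝ → ℝ} {K : NNReal} (hπ : LipschitzWith K π) (h0 : π 0 = 0)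
    {k : ℝ} (hk : 0 ≤ k) (hd : eLpNorm (deriv π) ∞ volume ≤ ENNReal.ofReal k) (r : ℝ) :
    |π r| ≤ k * |r| := by
  have hb : ∀ᵐ s, ‖deriv π s‖ ≤ k := by
    filter_upwards [ae_le_eLpNormEssSup (f := deriv π) (μ := volume)] with s hs
    rw [← eLpNorm_exponent_top, ← ofReal_norm] at hs
    exact (ENNReal.ofReal_le_ofReal_iff hk).1 (hs.trans hd)
  have h := (hπ.lipschitzOnWith (s := uIcc 0 r)).absolutelyContinuousOnInterval.integral_deriv_eq_sub
  rw [h0, sub_zero] at h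
  rw [← h, ← Real.norm_eq_abs]
  have h2 := intervalIntegral.norm_integral_le_of_norm_le_const_ae (a := (0 : ℝ)) (b := r)
    (hb.mono fun s hs _ => hs)
  rwa [sub_zero] at h2

end Nonlinearities

/-! ### Weak solutions in terms of Hilbert space valued functions -/

section WeakSolutions

open ContinuousLinearMap (adjoint)

variable {N : ℕ} {Ω : Set (EuclideanSpace ℝ (Fin N))} {T : ℝ}

/-- The evolution equation in `V*`, transported to `V` by the Riesz isomorphism. -/
lemma adjoint_eq_primitive {u : ℝ → L2 Ω} {μ : ℝ → H1 Ω} (hμ : MemLp μ 2 (timeMeasure T))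
    (h : ∃ u' : ℝ → VStar Ω, HasTimeDeriv T (fun t => toVStar (u t)) u' ∧
      ∀ᵐ t ∂timeMeasure T, ∀ z : H1 Ω, u' t z + ⟪μ t, z⟫_ℝ = 0) :
    ∀ t ∈ Icc 0 T, adjoint H1.toL2 (u t) =
      adjoint H1.toL2 (u 0) + ∫ s in (0 : ℝ)..t, (-μ) s := by
  obtain ⟨u', ⟨hu', hu⟩, heq⟩ := h
  intro t ht
  have h0 : (0 : ℝ) ∈ Icc 0 T := ⟨le_rfl, ht.1.trans ht.2⟩
  have hi' : IntervalIntegrable u' volume 0 t :=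
    intervalIntegrable_of_timeMeasure (hu'.integrable (by norm_num)) h0 ht
  have hiμ : IntervalIntegrable (-μ) volume 0 t :=
    intervalIntegrable_of_timeMeasure (hμ.neg.integrable (by norm_num)) h0 ht
  refine ext_inner_right ℝ fun z => ?_
  have h1 := congrArg (fun F : VStar Ω => F z) (hu t ht)
  simp only [add_apply] at h1
  rw [ContinuousLinearMap.intervalIntegral_apply hi'] at h1
  have h2 : ⟪∫ s in (0 : ℝ)..t, (-μ) s, z⟫_ℝ = ∫ s in (0 : ℝ)..t, ⟪(-μ) s, z⟫_ℝ := by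
    rw [real_inner_comm]
    have h3 := (innerSL ℝ z).intervalIntegral_comp_comm hiμ
    simp only [innerSL_apply_apply] at h3
    rw [← h3]
    exact intervalIntegral.integral_congr fun s _ => real_inner_comm _ _
  rw [inner_add_left, ContinuousLinearMap.adjoint_inner_left,
    ContinuousLinearMap.adjoint_inner_left, h2]
  refine h1.trans ?_
  congr 1
  refine intervalIntegral.integral_congr_ae ?_
  have hae := (ae_restrict_iff' measurableSet_Ioo).1 heq
  have hne : ∀ᵐ s : ℝ, s ≠ T := by simp [ae_iff, measure_singleton]
  filter_upwards [hae, hne] with s hs hsT hsI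
  rw [uIoc_of_le ht.1] at hsI
  have h4 := hs ⟨hsI.1, lt_of_le_of_ne (hsI.2.trans ht.2) hsT⟩ z
  rw [Pi.neg_apply, inner_neg_left]
  exact eq_neg_of_add_eq_zero_left h4

/-- For a weak solution `(u, μ)` of the limit problem, `b = μ + f ∈ L²(0, T; H)` represents
`β(u)`. -/
lemma IsWeakSolution.exists_beta {β : ℝ → ℝ} {f : ℝ → H2 Ω} {u₀ : L2 Ω} {u : ℝ → L2 Ω}
    {μ : ℝ → H1 Ω} (h : IsWeakSolution T β f u₀ u μ) (hf : MemLp f 2 (timeMeasure T)) :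
    ∃ b : ℝ → L2 Ω, MemLp b 2 (timeMeasure T) ∧ (∀ t, H1.toL2 (μ t) = b t - H2.toL2 (f t)) ∧
      ∀ᵐ t ∂timeMeasure T, ∀ᵐ x ∂volume.restrict Ω, b t x = β (u t x) := by
  refine ⟨fun t => H1.toL2 (μ t) + H2.toL2 (f t),
    (H1.toL2.comp_memLp' h.memLp_μ).add (H2.toL2.comp_memLp' hf), fun t => by simp, ?_⟩
  filter_upwards [h.potential] with t ht
  filter_upwards [ht, Lp.coeFn_add (H1.toL2 (μ t)) (H2.toL2 (f t))] with x hx hx'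
  rw [hx', Pi.add_apply, hx, sub_add_cancel]

/-- For a weak solution `(u, μ)` of the approximate problem, `w` is the representative of `u` in
`L²(0, T; W)`, and `b`, `p` represent `β(u)` and `π_ε(u)` in `L²(0, T; H)`. -/
lemma IsWeakSolutionEps.exists_beta {β π : ℝ → ℝ} {ε k : ℝ} {f : ℝ → H2 Ω} {u₀ε : H1 Ω}
    {u : ℝ → L2 Ω} {μ : ℝ → H1 Ω} (h : IsWeakSolutionEps T ε β π f u₀ε u μ)
    (hf : MemLp f 2 (timeMeasure T)) {K : NNReal} (hπ : LipschitzWith K π) (hπ0 : π 0 = 0)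
    (hπk : ∀ r, |π r| ≤ k * |r|) :
    ∃ (w : ℝ → W Ω) (b p : ℝ → L2 Ω), MemLp (fun t => W.negLaplacianAddOne (w t)) 2 (timeMeasure T) ∧
      MemLp b 2 (timeMeasure T) ∧ MemLp p 2 (timeMeasure T) ∧
      (∀ t, ‖p t‖ ≤ k * ‖u t‖) ∧
      (∀ t, H1.toL2 (μ t) =
        ε • W.negLaplacianAddOne (w t) + b t + p t - H2.toL2 (f t)) ∧
      (∀ᵐ t ∂timeMeasure T, W.toL2 (w t) = u t) ∧
      ∀ᵐ t ∂timeMeasure T, ∀ᵐ x ∂volume.restrict Ω, b t x = β (u t x) := by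
  obtain ⟨w, hw, hwu⟩ := h.memLp_W
  have ha : MemLp (fun t => W.negLaplacianAddOne (w t)) 2 (timeMeasure T) :=
    (negLaplacianAddOneL Ω).comp_memLp' hw
  have hu : MemLp u 2 (timeMeasure T) :=
    ((H2.toL2.comp (W Ω).subtypeL).comp_memLp' hw).ae_eq hwu
  have hpn : ∀ t, ‖hπ.compLp hπ0 (u t)‖ ≤ k * ‖u t‖ := fun t => by
    refine Lp.norm_le_mul_norm_of_ae_le_mul ?_
    filter_upwards [hπ.coeFn_compLp hπ0 (u t)] with x hx
    rw [hx]
    exact hπk _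
  have hp : MemLp (fun t => hπ.compLp hπ0 (u t)) 2 (timeMeasure T) :=
    hu.of_le_mul ((hπ.continuous_compLp hπ0).comp_aestronglyMeasurable hu.1)
      (Eventually.of_forall hpn)
  refine ⟨w, fun t => H1.toL2 (μ t) + H2.toL2 (f t) - ε • W.negLaplacianAddOne (w t) -
    hπ.compLp hπ0 (u t), fun t => hπ.compLp hπ0 (u t), ha,
    (((H1.toL2.comp_memLp' h.memLp_μ).add (H2.toL2.comp_memLp' hf)).sub (ha.const_smul ε)).sub hp,
    hp, hpn, fun t => by module, hwu, ?_⟩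
  filter_upwards [h.potential, hwu] with t ht htu
  filter_upwards [ht (w t) htu, hπ.coeFn_compLp hπ0 (u t),
    Lp.coeFn_sub (H1.toL2 (μ t) + H2.toL2 (f t) - ε • W.negLaplacianAddOne (w t))
      (hπ.compLp hπ0 (u t)),
    Lp.coeFn_sub (H1.toL2 (μ t) + H2.toL2 (f t)) (ε • W.negLaplacianAddOne (w t)),
    Lp.coeFn_add (H1.toL2 (μ t)) (H2.toL2 (f t)),
    Lp.coeFn_smul ε (W.negLaplacianAddOne (w t))] with x h1 h2 h3 h4 h5 h6
  rw [h3, Pi.sub_apply, h4, Pi.sub_apply, h5, Pi.add_apply, h6, Pi.smul_apply, h2, h1,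
    smul_eq_mul, Function.comp_apply]
  ring

lemma inner_nonneg_of_monotone {β : ℝ → ℝ} (hβ : Monotone β) {u u' b b' : L2 Ω}
    (hb : ∀ᵐ x ∂volume.restrict Ω, b x = β (u x)) (hb' : ∀ᵐ x ∂volume.restrict Ω, b' x = β (u' x)) :
    ⟪b - b', u - u'⟫_ℝ = (∫ x in Ω, (β (u x) - β (u' x)) * (u x - u' x)) ∧
      0 ≤ ⟪b - b', u - u'⟫_ℝ := by
  have e : ⟪b - b', u - u'⟫_ℝ = ∫ x in Ω, (β (u x) - β (u' x)) * (u x - u' x) := by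
    rw [L2_inner_eq]
    refine integral_congr_ae ?_
    filter_upwards [hb, hb', Lp.coeFn_sub b b', Lp.coeFn_sub u u'] with x h1 h2 h3 h4
    rw [h3, h4, Pi.sub_apply, Pi.sub_apply, h1, h2]
  refine ⟨e, e ▸ integral_nonneg fun x => ?_⟩
  rcases le_total (u x) (u' x) with h | h
  · exact mul_nonneg_of_nonpos_of_nonpos (sub_nonpos.2 (hβ h)) (sub_nonpos.2 h)
  · exact mul_nonneg (sub_nonneg.2 (hβ h)) (sub_nonneg.2 h)

lemma ae_le_of_memLp_top {X : Type*} [NormedAddCommGroup X] {u : ℝ → X}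
    (hu : MemLp u ∞ (timeMeasure T)) :
    ∀ᵐ t ∂timeMeasure T, ‖u t‖ ≤ (eLpNorm u ∞ (timeMeasure T)).toReal := by
  filter_upwards [ae_le_eLpNormEssSup (f := u) (μ := timeMeasure T)] with t ht
  rw [← eLpNorm_exponent_top, ← ofReal_norm] at ht
  exact (ENNReal.ofReal_le_iff_le_toReal hu.2.ne).1 ht

/-- Weak solutions of the limit problem are unique. -/
lemma IsWeakSolution.unique (hΩ : IsOpen Ω) {β : ℝ → ℝ} (hβ : Monotone β) {f : ℝ → H2 Ω}
    (hf : MemLp f 2 (timeMeasure T)) {u₀ : L2 Ω} {u v : ℝ → L2 Ω} {μ ν : ℝ → H1 Ω}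
    (hu : IsWeakSolution T β f u₀ u μ) (hv : IsWeakSolution T β f u₀ v ν) :
    ∀ t ∈ Icc 0 T, u t = v t := by
  intro t ht
  obtain ⟨b, hb, hμ, hbu⟩ := hu.exists_beta hf
  obtain ⟨c, hc, hν, hcv⟩ := hv.exists_beta hf
  have hprim := norm_sq_adjoint_primitive H1.toL2 (u := fun t => u t - v t)
    (U' := fun s => (-μ) s - (-ν) s) (hu.memLp_μ.neg.sub hv.memLp_μ.neg) (fun t ht => by
      have h0 : (0 : ℝ) ∈ Icc 0 T := ⟨le_rfl, ht.1.trans ht.2⟩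
      rw [map_sub, map_sub, adjoint_eq_primitive hu.memLp_μ hu.evolution t ht,
        adjoint_eq_primitive hv.memLp_μ hv.evolution t ht, intervalIntegral.integral_sub
        (intervalIntegrable_of_timeMeasure (hu.memLp_μ.neg.integrable (by norm_num)) h0 ht)
        (intervalIntegrable_of_timeMeasure (hv.memLp_μ.neg.integrable (by norm_num)) h0 ht)]
      abel) ht
  have hle : (∫ s in (0 : ℝ)..t, ⟪u s - v s, H1.toL2 ((-μ) s - (-ν) s)⟫_ℝ) ≤ 0 := by
    rw [intervalIntegral.integral_of_le ht.1, integral_Ioc_eq_integral_Ioo]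
    refine integral_nonpos_of_ae ?_
    have hmono := Measure.restrict_mono (Ioo_subset_Ioo_right ht.2 : Ioo 0 t ⊆ Ioo 0 T)
      (le_refl (volume : Measure ℝ))
    filter_upwards [ae_mono hmono hbu, ae_mono hmono hcv] with s h1 h2
    have e : H1.toL2 ((-μ) s - (-ν) s) = -(b s - c s) := by
      rw [Pi.neg_apply, Pi.neg_apply, map_sub, map_neg, map_neg, hμ, hν]
      abel
    rw [e, inner_neg_right, real_inner_comm, Pi.zero_apply, neg_nonpos]
    exact (inner_nonneg_of_monotone hβ h1 h2).2
  have hzero : adjoint H1.toL2 (u t - v t) = 0 := by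
    simp only [hu.initial, hv.initial, sub_self, map_zero, norm_zero] at hprim
    have : ‖adjoint H1.toL2 (u t - v t)‖ ^ 2 ≤ 0 := by linarith
    exact norm_eq_zero.1 (pow_eq_zero_iff two_ne_zero |>.1 (le_antisymm this (sq_nonneg _)))
  exact sub_eq_zero.1 (adjoint_toL2_injective hΩ hzero)

end WeakSolutions

/-! ### A priori estimates uniform in `ε` -/

section Estimates

open ContinuousLinearMap (adjoint)

variable {N : ℕ} {Ω : Set (EuclideanSpace ℝ (Fin N))} {T : ℝ}

lemma intervalIntegral_le_of_ae_le (hT : 0 < T) {F : ℝ → ℝ} (hF : Integrable F (timeMeasure T))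
    {C : ℝ} (h : ∀ᵐ t ∂timeMeasure T, ∫ s in (0 : ℝ)..t, F s ≤ C) :
    ∫ s in (0 : ℝ)..T, F s ≤ C := by
  have hint : IntervalIntegrable F volume 0 T :=
    intervalIntegrable_of_timeMeasure hF ⟨le_rfl, hT.le⟩ ⟨hT.le, le_rfl⟩
  have hcont : ContinuousOn (fun t => ∫ s in (0 : ℝ)..t, F s) (Icc 0 T) := by
    have h := intervalIntegral.continuousOn_primitive_interval' hint (left_mem_uIcc)
    rwa [uIcc_of_le hT.le] at h
  have heq : (fun t => max (∫ s in (0 : ℝ)..t, F s) C) =ᵐ[volume.restrict (Icc 0 T)] fun _ => C := by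
    rw [← restrict_Ioo_eq_restrict_Icc]
    filter_upwards [h] with t ht using max_eq_right ht
  have h2 := Measure.eqOn_Icc_of_ae_eq volume hT.ne heq (hcont.sup continuousOn_const)
    continuousOn_const ⟨hT.le, le_rfl⟩
  exact max_eq_right_iff.1 h2

/-- Testing the equation of the approximate problem with `u_ε` bounds `u_ε` in `L^∞(0, T; H)` and
`ε^{1/2} (-Δ + 1) u_ε` in `L²(0, T; H)`: the term with `β` is nonnegative, and the one with `f` equals
`(g, u_ε)_H`. -/
lemma IsWeakSolutionEps.apriori (hΩ : IsOpen Ω) (hT : 0 < T) {β π : ℝ → ℝ} (hβ : Monotone β)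
    (hβc : Continuous β) (hβ0 : β 0 = 0) {g : ℝ → L2 Ω} {f : ℝ → H2 Ω} (hgf : CondSource T g f)
    {ε k c : ℝ} (hε : 0 < ε) (hk : k ^ 2 * ε * T ≤ 1 / 4) {u₀ε : H1 Ω}
    (hu₀ε : ‖H1.toL2 u₀ε‖ ^ 2 ≤ c) {u : ℝ → L2 Ω} {μ : ℝ → H1 Ω}
    (h : IsWeakSolutionEps T ε β π f u₀ε u μ) {w : ℝ → W Ω} {b p : ℝ → L2 Ω}
    (ha : MemLp (fun t => W.negLaplacianAddOne (w t)) 2 (timeMeasure T))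
    (hp : ∀ t, ‖p t‖ ≤ k * ε * ‖u t‖)
    (hμ : ∀ t, H1.toL2 (μ t) = ε • W.negLaplacianAddOne (w t) + b t + p t - H2.toL2 (f t))
    (hwu : ∀ᵐ t ∂timeMeasure T, W.toL2 (w t) = u t)
    (hb : ∀ᵐ t ∂timeMeasure T, ∀ᵐ x ∂volume.restrict Ω, b t x = β (u t x)) :
    (∀ᵐ t ∂timeMeasure T, ‖u t‖ ^ 2 ≤ 2 * (c + 4 * (∫ t in Ioo 0 T, ‖g t‖) ^ 2)) ∧
      ε * (∫ t in (0 : ℝ)..T, ‖W.negLaplacianAddOne (w t)‖ ^ 2) ≤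
        2 * (c + 4 * (∫ t in Ioo 0 T, ‖g t‖) ^ 2) := by
  have hutop : MemLp u ∞ (timeMeasure T) := by
    obtain ⟨v, hv, hvu⟩ := h.memLp_V
    exact (H1.toL2.comp_memLp' hv).ae_eq hvu
  set S := (eLpNorm u ∞ (timeMeasure T)).toReal with hS
  have hS0 : 0 ≤ S := ENNReal.toReal_nonneg
  have huS := ae_le_of_memLp_top hutop
  set Γ := ∫ t in Ioo 0 T, ‖g t‖ with hΓ
  have hΓ0 : 0 ≤ Γ := integral_nonneg fun _ => norm_nonneg _
  have hgi : Integrable g (timeMeasure T) := hgf.memLp_g.integrable (by norm_num)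
  have ha2 : Integrable (fun t => ‖W.negLaplacianAddOne (w t)‖ ^ 2) (timeMeasure T) :=
    ha.integrable_norm_pow (by norm_num)
  have hadj : ∀ᵐ t ∂timeMeasure T,
      u t = H1.toL2 (adjoint H1.toL2 (W.negLaplacianAddOne (w t))) := by
    filter_upwards [hwu] with t ht
    rw [W.adjoint_negLaplacianAddOne, ← ht]
    rfl
  have henergy := norm_sq_le_of_primitive H1.toL2 h.memLp_μ.neg ha
    (adjoint_eq_primitive h.memLp_μ h.evolution) hadj
  have hpt : ∀ᵐ s ∂timeMeasure T,
      2 * ⟪W.negLaplacianAddOne (w s), H1.toL2 ((-μ) s)⟫_ℝ ≤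
        (k ^ 2 * ε * S ^ 2 + 2 * S * ‖g s‖) - ε * ‖W.negLaplacianAddOne (w s)‖ ^ 2 := by
    filter_upwards [huS, hwu, hb, hgf.neumann, hgf.equation] with s h1 h2 h3 h4 h5
    set a := W.negLaplacianAddOne (w s)
    have hab : 0 ≤ ⟪a, b s⟫_ℝ := by
      have hbs : ∀ᵐ x ∂volume.restrict Ω, b s x = β (W.toL2 (w s) x) := by rwa [h2]
      have h6 := integral_comp_mul_nonneg hΩ (w s) hβc hβ hβ0 ((Lp.memLp (b s)).ae_eq hbs)
      rw [L2_inner_eq]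
      refine h6.trans_eq (integral_congr_ae ?_)
      filter_upwards [hbs] with x hx
      rw [hx, mul_comm]
    have haf : ⟪a, H2.toL2 (f s)⟫_ℝ ≤ S * ‖g s‖ := by
      have h6 := W.inner_negLaplacianAddOne_comm (w s) ⟨f s, h4⟩
      have h7 : W.negLaplacianAddOne ⟨f s, h4⟩ = g s := h5
      rw [h7, h2] at h6
      exact h6.trans_le ((real_inner_le_norm _ _).trans
        (mul_le_mul_of_nonneg_right h1 (norm_nonneg _)))
    have hap : -⟪a, p s⟫_ℝ ≤ ‖a‖ * (k * ε * ‖u s‖) :=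
      (neg_le_abs _).trans ((abs_real_inner_le_norm _ _).trans
        (mul_le_mul_of_nonneg_left (hp s) (norm_nonneg _)))
    have hyoung : 2 * (‖a‖ * (k * ε * ‖u s‖)) ≤ ε * ‖a‖ ^ 2 + k ^ 2 * ε * ‖u s‖ ^ 2 := by
      nlinarith [mul_nonneg hε.le (sq_nonneg (‖a‖ - k * ‖u s‖))]
    have hus : k ^ 2 * ε * ‖u s‖ ^ 2 ≤ k ^ 2 * ε * S ^ 2 :=
      mul_le_mul_of_nonneg_left (pow_le_pow_left₀ (norm_nonneg _) h1 2) (by positivity)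
    rw [Pi.neg_apply, map_neg, inner_neg_right, hμ, inner_sub_right, inner_add_right,
      inner_add_right, real_inner_smul_right, real_inner_self_eq_norm_sq]
    linarith
  have hmain : ∀ᵐ t ∂timeMeasure T,
      ‖u t‖ ^ 2 + ε * (∫ s in (0 : ℝ)..t, ‖W.negLaplacianAddOne (w s)‖ ^ 2) ≤
        c + S ^ 2 / 4 + 2 * S * Γ := by
    filter_upwards [henergy, ae_restrict_mem measurableSet_Ioo] with t ht htI
    have h0 : (0 : ℝ) ∈ Icc 0 T := ⟨le_rfl, hT.le⟩
    have htI' : t ∈ Icc 0 T := ⟨htI.1.le, htI.2.le⟩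
    have i1 := intervalIntegrable_of_timeMeasure ha2 h0 htI'
    have i2 := intervalIntegrable_of_timeMeasure hgi.norm h0 htI'
    have i3 := intervalIntegrable_of_timeMeasure
      (integrable_inner_of_memLp_two ha (H1.toL2.comp_memLp' h.memLp_μ.neg)) h0 htI'
    have i4 : IntervalIntegrable (fun s => k ^ 2 * ε * S ^ 2 + 2 * S * ‖g s‖) volume 0 t :=
      intervalIntegrable_const.add (i2.const_mul (2 * S))
    have hsub : Ioo 0 t ⊆ Ioo 0 T := Ioo_subset_Ioo_right htI.2.le
    have hle : (∫ s in (0 : ℝ)..t, 2 * ⟪W.negLaplacianAddOne (w s), H1.toL2 ((-μ) s)⟫_ℝ) ≤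
        ∫ s in (0 : ℝ)..t, ((k ^ 2 * ε * S ^ 2 + 2 * S * ‖g s‖) -
          ε * ‖W.negLaplacianAddOne (w s)‖ ^ 2) := by
      rw [intervalIntegral.integral_of_le htI.1.le, intervalIntegral.integral_of_le htI.1.le]
      refine integral_mono_ae (i3.const_mul 2).1 (i4.sub (i1.const_mul ε)).1 ?_
      rw [← restrict_Ioo_eq_restrict_Ioc]
      exact ae_mono (Measure.restrict_mono hsub le_rfl) hpt
    rw [intervalIntegral.integral_const_mul, intervalIntegral.integral_sub i4 (i1.const_mul ε),
      intervalIntegral.integral_add intervalIntegrable_const (i2.const_mul (2 * S)),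
      intervalIntegral.integral_const, intervalIntegral.integral_const_mul,
      intervalIntegral.integral_const_mul, sub_zero, smul_eq_mul] at hle
    have hg' : (∫ s in (0 : ℝ)..t, ‖g s‖) ≤ Γ := by
      rw [intervalIntegral.integral_of_le htI.1.le, integral_Ioc_eq_integral_Ioo]
      exact setIntegral_mono_set hgi.norm (Eventually.of_forall fun _ => norm_nonneg _)
        hsub.eventuallyLE
    have hgS := mul_le_mul_of_nonneg_left hg' (by positivity : 0 ≤ 2 * S)
    have hkT : t * (k ^ 2 * ε * S ^ 2) ≤ S ^ 2 / 4 := by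
      have h1 : t * (k ^ 2 * ε * S ^ 2) ≤ T * (k ^ 2 * ε * S ^ 2) :=
        mul_le_mul_of_nonneg_right htI.2.le (by positivity)
      nlinarith [mul_le_mul_of_nonneg_right hk (sq_nonneg S)]
    rw [h.initial] at ht
    linarith
  have hB : 0 ≤ c + S ^ 2 / 4 + 2 * S * Γ := by
    have := (sq_nonneg _).trans hu₀ε
    positivity
  have hSB : S ^ 2 ≤ c + S ^ 2 / 4 + 2 * S * Γ := by
    have h1 : eLpNorm u ∞ (timeMeasure T) ≤
        ENNReal.ofReal (Real.sqrt (c + S ^ 2 / 4 + 2 * S * Γ)) := by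
      rw [eLpNorm_exponent_top]
      refine eLpNormEssSup_le_of_ae_bound ?_
      filter_upwards [hmain, ae_restrict_mem measurableSet_Ioo] with t ht htI
      refine Real.le_sqrt_of_sq_le (le_trans ?_ ht)
      exact le_add_of_nonneg_right (mul_nonneg hε.le
        (intervalIntegral.integral_nonneg htI.1.le fun s _ => sq_nonneg _))
    have h2 := ENNReal.toReal_le_of_le_ofReal (Real.sqrt_nonneg _) h1
    calc S ^ 2 ≤ Real.sqrt (c + S ^ 2 / 4 + 2 * S * Γ) ^ 2 := pow_le_pow_left₀ hS0 h2 2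
      _ = _ := Real.sq_sqrt hB
  have hR : c + S ^ 2 / 4 + 2 * S * Γ ≤ 2 * (c + 4 * Γ ^ 2) := by
    nlinarith [sq_nonneg (S - 4 * Γ)]
  constructor
  · filter_upwards [huS] with t ht
    exact (pow_le_pow_left₀ (norm_nonneg _) ht 2).trans (hSB.trans hR)
  · rw [← intervalIntegral.integral_const_mul]
    refine intervalIntegral_le_of_ae_le hT (ha2.const_mul ε) ?_
    filter_upwards [hmain] with t ht
    rw [intervalIntegral.integral_const_mul]
    linarith [sq_nonneg ‖u t‖]

/-! ### The error estimate -/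

/-- The error estimate up to time `t`, given bounds `M` on `u`, `R` on `u_ε` and `R²` on
`ε ∫ ‖(-Δ + 1) u_ε‖²`. The factor `ε^{1/2}` comes from the initial values and from
`2 ε ‖A u_ε‖ M ≤ ε^{1/2} (ε ‖A u_ε‖² + M²)` with `A = -Δ + 1`. -/
lemma error_estimate (hT : 0 < T) {β π : ℝ → ℝ}
    {f : ℝ → H2 Ω} {ε k R M c : ℝ} (hε : 0 < ε) (hε1 : ε ≤ 1) (hk : 0 ≤ k) (hR : 0 ≤ R) (hM : 0 ≤ M)
    {u₀ : L2 Ω} {u₀ε : H1 Ω} {u uε : ℝ → L2 Ω} {μ με : ℝ → H1 Ω} (h : IsWeakSolution T β f u₀ u μ)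
    (hε' : IsWeakSolutionEps T ε β π f u₀ε uε με)
    (hu₀ : ‖adjoint H1.toL2 (H1.toL2 u₀ε - u₀)‖ ≤ c * ε ^ (1 / 4 : ℝ))
    {w : ℝ → W Ω} {b bε p : ℝ → L2 Ω}
    (ha : MemLp (fun t => W.negLaplacianAddOne (w t)) 2 (timeMeasure T))
    (hbm : MemLp b 2 (timeMeasure T)) (hbεm : MemLp bε 2 (timeMeasure T))
    (hp : ∀ t, ‖p t‖ ≤ k * ε * ‖uε t‖)
    (hμ : ∀ t, H1.toL2 (μ t) = b t - H2.toL2 (f t))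
    (hμε : ∀ t, H1.toL2 (με t) = ε • W.negLaplacianAddOne (w t) + bε t + p t - H2.toL2 (f t))
    (hwu : ∀ᵐ t ∂timeMeasure T, W.toL2 (w t) = uε t)
    (hM' : ∀ᵐ t ∂timeMeasure T, ‖u t‖ ≤ M) (hR' : ∀ᵐ t ∂timeMeasure T, ‖uε t‖ ≤ R)
    (haR : ε * (∫ t in (0 : ℝ)..T, ‖W.negLaplacianAddOne (w t)‖ ^ 2) ≤ R ^ 2)
    {t : ℝ} (ht : t ∈ Icc 0 T) :
    ‖adjoint H1.toL2 (uε t - u t)‖ ^ 2 + 2 * (∫ s in (0 : ℝ)..t, ⟪bε s - b s, uε s - u s⟫_ℝ) ≤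
      (c ^ 2 + R ^ 2 + M ^ 2 * T + 2 * k * R * (R + M) * T) * ε ^ (1 / 2 : ℝ) := by
  have hu2 : MemLp u 2 (timeMeasure T) := h.memLp_u.mono_exponent le_top
  have huε2 : MemLp uε 2 (timeMeasure T) := by
    obtain ⟨v, hv, hvu⟩ := hε'.memLp_V
    exact ((H1.toL2.comp_memLp' hv).ae_eq hvu).mono_exponent le_top
  have h0 : (0 : ℝ) ∈ Icc 0 T := ⟨le_rfl, hT.le⟩
  have hprim := norm_sq_adjoint_primitive H1.toL2 (u := fun t => uε t - u t)
    (U' := fun s => (-με) s - (-μ) s) (hε'.memLp_μ.neg.sub h.memLp_μ.neg) (fun t ht => by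
      rw [map_sub, map_sub, adjoint_eq_primitive hε'.memLp_μ hε'.evolution t ht,
        adjoint_eq_primitive h.memLp_μ h.evolution t ht, intervalIntegral.integral_sub
        (intervalIntegrable_of_timeMeasure (hε'.memLp_μ.neg.integrable (by norm_num)) h0 ht)
        (intervalIntegrable_of_timeMeasure (h.memLp_μ.neg.integrable (by norm_num)) h0 ht)]
      abel) ht
  simp only [hε'.initial, h.initial] at hprim
  set η := ε ^ (1 / 2 : ℝ) with hη
  have hη0 : 0 < η := Real.rpow_pos_of_pos hε _
  have hηη : η ^ 2 = ε := by
    rw [hη, ← Real.rpow_natCast, ← Real.rpow_mul hε.le]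
    norm_num
  have hεη : ε ≤ η := by nlinarith [hηη, Real.rpow_le_one hε.le hε1 (by norm_num : (0 : ℝ) ≤ 1 / 2)]
  have hinit : ‖adjoint H1.toL2 (H1.toL2 u₀ε - u₀)‖ ^ 2 ≤ c ^ 2 * η := by
    have h1 := pow_le_pow_left₀ (norm_nonneg _) hu₀ 2
    have h2 : (ε ^ (1 / 4 : ℝ)) ^ 2 = η := by
      rw [hη, ← Real.rpow_natCast, ← Real.rpow_mul hε.le]
      norm_num
    rwa [mul_pow, h2] at h1
  have iq : IntervalIntegrable (fun s => ⟪bε s - b s, uε s - u s⟫_ℝ) volume 0 t :=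
    intervalIntegrable_of_timeMeasure
    (integrable_inner_of_memLp_two (hbεm.sub hbm) (huε2.sub hu2)) h0 ht
  have ha2 : Integrable (fun t => ‖W.negLaplacianAddOne (w t)‖ ^ 2) (timeMeasure T) :=
    ha.integrable_norm_pow (by norm_num)
  have i1 := intervalIntegrable_of_timeMeasure ha2 h0 ht
  have iL := intervalIntegrable_of_timeMeasure (integrable_inner_of_memLp_two (huε2.sub hu2)
    (H1.toL2.comp_memLp' (hε'.memLp_μ.neg.sub h.memLp_μ.neg))) h0 ht
  have hpt : ∀ᵐ s ∂timeMeasure T,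
      2 * ⟪uε s - u s, H1.toL2 ((-με) s - (-μ) s)⟫_ℝ ≤
        (η * (ε * ‖W.negLaplacianAddOne (w s)‖ ^ 2) +
          (η * M ^ 2 + η * (2 * k * R * (R + M)))) - 2 * ⟪bε s - b s, uε s - u s⟫_ℝ := by
    filter_upwards [hwu, hM', hR'] with s h1 h2 h3
    have hp' := hp s
    set a := W.negLaplacianAddOne (w s)
    have hau : 0 ≤ ⟪uε s, a⟫_ℝ := by
      have h4 := W.inner_toH1 (w s) (H2.toH1 (w s).1)
      rw [real_inner_self_eq_norm_sq] at h4
      rw [← h1, real_inner_comm]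
      exact (sq_nonneg _).trans_eq h4
    have hau' : ⟪u s, a⟫_ℝ ≤ M * ‖a‖ :=
      (real_inner_le_norm _ _).trans (mul_le_mul_of_nonneg_right h2 (norm_nonneg _))
    have hyoung : 2 * (ε * (M * ‖a‖)) ≤ η * (ε * ‖a‖ ^ 2) + η * M ^ 2 := by
      have h5 := mul_nonneg hη0.le (sq_nonneg (η * ‖a‖ - M))
      rw [← hηη]
      nlinarith
    have hpw : -⟪uε s - u s, p s⟫_ℝ ≤ (R + M) * (k * ε * R) := by
      refine (neg_le_abs _).trans ((abs_real_inner_le_norm _ _).trans ?_)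
      refine mul_le_mul ((norm_sub_le _ _).trans (add_le_add h3 h2))
        (hp'.trans (mul_le_mul_of_nonneg_left h3 (by positivity))) (norm_nonneg _) (by positivity)
    have hpη : (R + M) * (k * ε * R) ≤ η * (k * R * (R + M)) := by
      have h6 := mul_le_mul_of_nonneg_right hεη (by positivity : 0 ≤ k * R * (R + M))
      nlinarith
    have e : H1.toL2 ((-με) s - (-μ) s) = -(ε • a + (bε s - b s) + p s) := by
      rw [Pi.neg_apply, Pi.neg_apply, map_sub, map_neg, map_neg, hμ, hμε]
      module
    rw [e, inner_neg_right, inner_add_right, inner_add_right, real_inner_smul_right,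
      inner_sub_left (uε s) (u s) a, real_inner_comm (bε s - b s)]
    nlinarith [mul_nonneg hε.le hau, mul_le_mul_of_nonneg_left hau' hε.le]
  have hle : (∫ s in (0 : ℝ)..t, 2 * ⟪uε s - u s, H1.toL2 ((-με) s - (-μ) s)⟫_ℝ) ≤
      ∫ s in (0 : ℝ)..t, ((η * (ε * ‖W.negLaplacianAddOne (w s)‖ ^ 2) +
        (η * M ^ 2 + η * (2 * k * R * (R + M)))) - 2 * ⟪bε s - b s, uε s - u s⟫_ℝ) := by
    rw [intervalIntegral.integral_of_le ht.1, intervalIntegral.integral_of_le ht.1]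
    refine integral_mono_ae (iL.const_mul 2).1
      ((((i1.const_mul ε).const_mul η).add intervalIntegrable_const).sub (iq.const_mul 2)).1 ?_
    rw [← restrict_Ioo_eq_restrict_Ioc]
    exact ae_mono (Measure.restrict_mono (Ioo_subset_Ioo_right ht.2) le_rfl) hpt
  rw [intervalIntegral.integral_const_mul, intervalIntegral.integral_sub
    (((i1.const_mul ε).const_mul η).add intervalIntegrable_const) (iq.const_mul 2),
    intervalIntegral.integral_add ((i1.const_mul ε).const_mul η) intervalIntegrable_const,
    intervalIntegral.integral_const, intervalIntegral.integral_const_mul,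
    intervalIntegral.integral_const_mul, intervalIntegral.integral_const_mul, sub_zero,
    smul_eq_mul] at hle
  have hat : (∫ s in (0 : ℝ)..t, ‖W.negLaplacianAddOne (w s)‖ ^ 2) ≤
      ∫ s in (0 : ℝ)..T, ‖W.negLaplacianAddOne (w s)‖ ^ 2 :=
    intervalIntegral.integral_mono_interval le_rfl ht.1 ht.2
      (Eventually.of_forall fun _ => sq_nonneg _)
      (intervalIntegrable_of_timeMeasure ha2 h0 ⟨hT.le, le_rfl⟩)
  have h7 := mul_le_mul_of_nonneg_left ((mul_le_mul_of_nonneg_left hat hε.le).trans haR) hη0.le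
  have h8 : t * (η * M ^ 2 + η * (2 * k * R * (R + M))) ≤
      T * (η * M ^ 2 + η * (2 * k * R * (R + M))) :=
    mul_le_mul_of_nonneg_right ht.2 (by positivity)
  rw [hprim]
  linarith

end Estimates

end QuasilinearParabolic

end

open QuasilinearParabolic

theorem theorem5p1 {N : ℕ} (Ω : Set (EuclideanSpace ℝ (Fin N)))
    (hΩ : QuasilinearParabolic.IsAdmissibleDomain Ω) (T : ℝ) (hT : 0 < T)
    (β βhat : ℝ → ℝ) (c₁ : ℝ) (hβ : QuasilinearParabolic.CondBeta Ω β βhat c₁)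
    (g : ℝ → QuasilinearParabolic.L2 Ω) (f : ℝ → QuasilinearParabolic.H2 Ω)
    (hgf : QuasilinearParabolic.CondSource T g f)
    (u₀ : QuasilinearParabolic.L2 Ω) (hu₀ : QuasilinearParabolic.CondInit βhat u₀)
    (P : ℝ → ℝ → ℝ) (c₂ : ℝ → ℝ) (hP : QuasilinearParabolic.CondPi P c₂ c₁)
    (u₀ε : ℝ → QuasilinearParabolic.H1 Ω) (c₃ : ℝ → ℝ)
    (hu₀ε : QuasilinearParabolic.CondInitEps βhat u₀ε c₃)
    (c₂' c₃' c₄ : ℝ) (hc₂'pos : 0 < c₂') (hc₃'pos : 0 < c₃') (hc₄pos : 0 < c₄)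
    (hc₂ : ∀ ε ∈ Set.Ioc (0 : ℝ) 1, c₂ ε = c₂' * ε)
    (hc₃ : ∀ ε ∈ Set.Ioc (0 : ℝ) 1, c₃ ε = c₃')
    (hc₄ : ∀ ε ∈ Set.Ioc (0 : ℝ) 1,
      ‖QuasilinearParabolic.toVStar (QuasilinearParabolic.H1.toL2 (u₀ε ε)) -
        QuasilinearParabolic.toVStar u₀‖ ≤ c₄ * ε ^ (1 / 4 : ℝ)) :
    ∃ Cstar > (0 : ℝ), ∃ εbar ∈ Set.Ioc (0 : ℝ) 1,
      ∀ (u : ℝ → QuasilinearParabolic.L2 Ω) (μ : ℝ → QuasilinearParabolic.H1 Ω),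
        QuasilinearParabolic.IsWeakSolution T β f u₀ u μ →
      ∀ ε ∈ Set.Ioc (0 : ℝ) εbar,
      ∀ (uε : ℝ → QuasilinearParabolic.L2 Ω) (με : ℝ → QuasilinearParabolic.H1 Ω),
        QuasilinearParabolic.IsWeakSolutionEps T ε β (P ε) f (u₀ε ε) uε με →
      -- the pairing `(β(uε(t)) - β(u(t)), uε(t) - u(t))_H` is defined for a.a. `t`
      (∀ᵐ t ∂QuasilinearParabolic.timeMeasure T,
        MemLp (fun x => β (uε t x)) 2 (volume.restrict Ω) ∧
        MemLp (fun x => β (u t x)) 2 (volume.restrict Ω)) ∧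
      -- and integrable in time
      Integrable (fun t => ∫ x in Ω, (β (uε t x) - β (u t x)) * (uε t x - u t x))
        (QuasilinearParabolic.timeMeasure T) ∧
      -- the error estimate, with `d` the element `uε - u` of `C([0, T]; V*)`
      ∃ d : C(Set.Icc (0 : ℝ) T, QuasilinearParabolic.VStar Ω),
        (∀ t : Set.Icc (0 : ℝ) T, d t =
          QuasilinearParabolic.toVStar (uε t) - QuasilinearParabolic.toVStar (u t)) ∧
        ‖d‖ ^ 2 +
          ∫ t in Set.Ioo (0 : ℝ) T, ∫ x in Ω, (β (uε t x) - β (u t x)) * (uε t x - u t x)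
          ≤ Cstar * ε ^ (1 / 2 : ℝ) := by
  have hβc := hβ.continuous
  have hβm := hβ.monotone
  have hβ0 := hβ.apply_zero
  have hf := hgf.memLp_f
  set R := Real.sqrt (2 * (c₃' + 4 * (∫ t in Ioo 0 T, ‖g t‖) ^ 2)) with hRdef
  have hR0 : 0 ≤ R := Real.sqrt_nonneg _
  have hRsq : R ^ 2 = 2 * (c₃' + 4 * (∫ t in Ioo 0 T, ‖g t‖) ^ 2) :=
    Real.sq_sqrt (by positivity)
  -- by uniqueness, one bound serves for all weak solutions of the limit problem
  obtain ⟨M, hM0, hM⟩ : ∃ M : ℝ, 0 ≤ M ∧ ∀ u μ, IsWeakSolution T β f u₀ u μ →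
      ∀ᵐ t ∂timeMeasure T, ‖u t‖ ≤ M := by
    by_cases hex : ∃ v ν, IsWeakSolution T β f u₀ v ν
    · obtain ⟨v, ν, hv⟩ := hex
      refine ⟨(eLpNorm v ∞ (timeMeasure T)).toReal, ENNReal.toReal_nonneg, fun u μ hu => ?_⟩
      filter_upwards [ae_le_of_memLp_top hv.memLp_u, ae_restrict_mem measurableSet_Ioo] with t ht htI
      rwa [hu.unique hΩ.isOpen hβm hf hv t ⟨htI.1.le, htI.2.le⟩]
    · exact ⟨0, le_rfl, fun u μ hu => (hex ⟨u, μ, hu⟩).elim⟩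
  set X := c₄ ^ 2 + R ^ 2 + M ^ 2 * T + 2 * c₂' * R * (R + M) * T with hX
  have hXpos : 0 < X := by positivity
  have hk : 0 < 4 * c₂' ^ 2 * T := by positivity
  -- the smallness of `ε` lets the `π_ε` term be absorbed in the a priori estimate
  refine ⟨2 * X, by positivity, min 1 (1 / (4 * c₂' ^ 2 * T)), ⟨by positivity, min_le_left _ _⟩,
    fun u μ hu ε hε uε με huε => ?_⟩
  have hε1 : ε ≤ 1 := hε.2.trans (min_le_left _ _)
  have hεI : ε ∈ Ioc (0 : ℝ) 1 := ⟨hε.1, hε1⟩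
  have hεk : c₂' ^ 2 * ε * T ≤ 1 / 4 := by
    have h := (le_div_iff₀ hk).1 (hε.2.trans (min_le_right _ _))
    linarith
  obtain ⟨K, hK⟩ := hP.lipschitz ε hεI
  have hPk : ∀ r, |P ε r| ≤ c₂' * ε * |r| := by
    refine abs_le_of_eLpNorm_deriv_le hK (hP.map_zero ε hεI) (mul_pos hc₂'pos hε.1).le ?_
    rw [← hc₂ ε hεI]
    exact hP.deriv_bound ε hεI
  obtain ⟨b, hbm, hμ, hb⟩ := hu.exists_beta hf
  obtain ⟨w, bε, p, ha, hbεm, -, hp, hμε, hwu, hbε⟩ :=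
    huε.exists_beta hf hK (hP.map_zero ε hεI) hPk
  have hu0 : ‖H1.toL2 (u₀ε ε)‖ ^ 2 ≤ c₃' := by
    rw [← hc₃ ε hεI]
    exact hu₀ε.norm_L2 ε hεI
  obtain ⟨huR, haR⟩ := huε.apriori hΩ.isOpen hT hβm hβc hβ0 hgf hε.1 hεk hu0 ha hp hμε hwu hbε
  have hinit := hc₄ ε hεI
  rw [norm_toVStar_sub] at hinit
  have herr := fun t (ht : t ∈ Icc 0 T) => error_estimate hT hε.1 hε1 hc₂'pos.le hR0 hM0
    hu huε hinit ha hbm hbεm hp hμ hμε hwu (hM u μ hu)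
    (huR.mono fun t ht => Real.le_sqrt_of_sq_le ht) (haR.trans_eq hRsq.symm) ht
  have hpair : ∀ᵐ t ∂timeMeasure T,
      ⟪bε t - b t, uε t - u t⟫_ℝ = ∫ x in Ω, (β (uε t x) - β (u t x)) * (uε t x - u t x) := by
    filter_upwards [hbε, hb] with t h1 h2 using (inner_nonneg_of_monotone hβm h1 h2).1
  have hnn : ∀ᵐ t ∂timeMeasure T, 0 ≤ ⟪bε t - b t, uε t - u t⟫_ℝ := by
    filter_upwards [hbε, hb] with t h1 h2 using (inner_nonneg_of_monotone hβm h1 h2).2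
  have hu2 : MemLp u 2 (timeMeasure T) := hu.memLp_u.mono_exponent le_top
  have huε2 : MemLp uε 2 (timeMeasure T) := by
    obtain ⟨v, hv, hvu⟩ := huε.memLp_V
    exact ((H1.toL2.comp_memLp' hv).ae_eq hvu).mono_exponent le_top
  have hcont : ∀ {v : ℝ → L2 Ω} {v' : ℝ → VStar Ω}, HasTimeDeriv T (fun t => toVStar (v t)) v' →
      ContinuousOn (fun t => toVStar (v t)) (Icc 0 T) := fun {v v'} hv => by
    have hint : IntervalIntegrable v' volume 0 T :=
      intervalIntegrable_of_timeMeasure (hv.1.integrable (by norm_num)) ⟨le_rfl, hT.le⟩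
        ⟨hT.le, le_rfl⟩
    have h := intervalIntegral.continuousOn_primitive_interval' hint left_mem_uIcc
    rw [uIcc_of_le hT.le] at h
    exact (h.const_add _).congr hv.2
  have hd : Continuous fun t : Icc (0 : ℝ) T => toVStar (uε t) - toVStar (u t) := by
    obtain ⟨v', hv', -⟩ := hu.evolution
    obtain ⟨vε', hvε', -⟩ := huε.evolution
    exact continuousOn_iff_continuous_domRestrict.1 ((hcont hvε').sub (hcont hv'))
  let d : C(Icc (0 : ℝ) T, VStar Ω) := ⟨fun t => toVStar (uε t) - toVStar (u t), hd⟩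
  refine ⟨?_, (integrable_inner_of_memLp_two (hbεm.sub hbm) (huε2.sub hu2)).congr hpair,
    d, fun t => rfl, ?_⟩
  · filter_upwards [hbε, hb] with t h1 h2 using
      ⟨(Lp.memLp (bε t)).ae_eq h1, (Lp.memLp (b t)).ae_eq h2⟩
  · have hη : 0 < ε ^ (1 / 2 : ℝ) := Real.rpow_pos_of_pos hε.1 _
    have hint : ∀ t ∈ Icc 0 T, 0 ≤ ∫ s in (0 : ℝ)..t, ⟪bε s - b s, uε s - u s⟫_ℝ := by
      intro t ht
      rw [intervalIntegral.integral_of_le ht.1, integral_Ioc_eq_integral_Ioo]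
      exact integral_nonneg_of_ae
        (ae_mono (Measure.restrict_mono (Ioo_subset_Ioo_right ht.2) le_rfl) hnn)
    have h1 : (∫ t in Ioo 0 T, ∫ x in Ω, (β (uε t x) - β (u t x)) * (uε t x - u t x)) =
        ∫ s in (0 : ℝ)..T, ⟪bε s - b s, uε s - u s⟫_ℝ := by
      rw [intervalIntegral.integral_of_le hT.le, integral_Ioc_eq_integral_Ioo]
      exact (integral_congr_ae hpair).symm
    have h2 := herr T ⟨hT.le, le_rfl⟩
    have h3 : ‖d‖ ≤ Real.sqrt (X * ε ^ (1 / 2 : ℝ)) := by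
      refine (ContinuousMap.norm_le _ (Real.sqrt_nonneg _)).2 fun t => ?_
      change ‖toVStar (uε t) - toVStar (u t)‖ ≤ _
      rw [norm_toVStar_sub]
      refine Real.le_sqrt_of_sq_le ?_
      linarith [herr t t.2, hint t t.2]
    have h4 : ‖d‖ ^ 2 ≤ X * ε ^ (1 / 2 : ℝ) :=
      calc ‖d‖ ^ 2 ≤ Real.sqrt (X * ε ^ (1 / 2 : ℝ)) ^ 2 := pow_le_pow_left₀ (norm_nonneg d) h3 2
        _ = X * ε ^ (1 / 2 : ℝ) := Real.sq_sqrt (by positivity)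
    have h5 : (∫ s in (0 : ℝ)..T, ⟪bε s - b s, uε s - u s⟫_ℝ) ≤ X * ε ^ (1 / 2 : ℝ) := by
      linarith [sq_nonneg ‖ContinuousLinearMap.adjoint H1.toL2 (uε T - u T)‖,
        hint T ⟨hT.le, le_rfl⟩]
    rw [h1, two_mul, add_mul]
    exact add_le_add h4 h5
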